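/- Let $g,m,n\ge 0$ be integers, let $\Omega=\{x_1,y_1,\dots,x_g,y_g\}$ be a set of $2g$ letters (colors), let $\alpha$ be one further color, and let $\mathbb F=\mathbb C(q,x_1,y_1,\dots,x_g,y_g)$. **Prismatic tangles.** An $\Omega$-prismatic tangle diagram is an oriented virtual tangle diagram whose components are colored by $\{\alpha\}\cup\Omega$ such that in every classical crossing the under-strand has color $\alpha$ and any classical crossing involving an $\Omega$-colored strand has that strand as its over-strand (so $\Omega$-colored strands meet each other only in virtual crossings). Its domain (bottom ends) and codomain (top ends) are finite sequences of symbols $\boxplus^c,\boxminus^c$ ($c$ a color) recording color and orientation, $\boxplus$ meaning upwards; diagrams compose by stacking. Every diagram is a composition of slices $\mathrm{id}\otimes e\otimes\mathrm{id}$ with $e$ an elementary tangle: an upward positive, negative or virtual crossing, a cup or a cap. Consider the following local moves, all diagrams involved being $\Omega$-prismatic. (i) Planar isotopy, the classical second and third Reidemeister moves, the virtual second and third Reidemeister moves and the mixed (virtual strand past a classical crossing) third Reidemeister move, for all orientations and admissible colors; cancellation of two consecutive classical curls of opposite signs on an $\alpha$-strand. (ii) The first virtual Reidemeister move on strands with colors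 in $\Omega$. (iii) The $\Omega$-semi-welded move: a strand with color in $\Omega$ that passes over two $\alpha$-strands is moved across a virtual crossing of these two strands. (iv) The $\Omega$-commutator move: an $\alpha$-strand (of either orientation) that, from left to right, passes under parallel strands of colors and directions $x_1$ up, $y_1$ up, $x_1$ down, $y_1$ down, $\dots$, $x_g$ up, $y_g$ up, $x_g$ down, $y_g$ down is released from all of them, i.e. these $4g$ classical crossings are replaced by virtual ones. (v) The classical first Reidemeister move on $\alpha$-strands and the first virtual Reidemeister move on strands of any color. The category $\mathcal{PT}^{fr,rot}_\Omega$ of framed rotational $\Omega$-prismatic tangles has as morphisms the diagrams modulo (i)–(iv); the category $\mathcal{PT}_\Omega$ has as morphisms the diagrams modulo (i)–(v). **The assignment $\widetilde Q^{m|n}_\Omega$.** Let $V$ be the $\mathbb F$-vector space with basis $v_1,\dots,v_{m+n}$, where $|i|=0$ for $i\le m$ and $|i|=1$ for $i>m$. Put $\widetilde Q(\boxplus^\alpha)=V$, $\widetilde Q(\boxminus^\alpha)=V^*$, $\widetilde Q(\boxplus^z)=\widetilde Q(\boxminus^z)=\mathbb F$ for $z\in\Omega$, $\widetilde Q(\varnothing)=\mathbb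 F$, and let a sequence go to the tensor product of the spaces of its entries. Elementary tangles, read from bottom to top, have these values. Positive $\alpha$–$\alpha$ crossing: $v_i\otimes v_j\mapsto q^{-1}v_i\otimes v_i$ if $i=j\le m$; $-q\,v_i\otimes v_i$ if $i=j>m$; $(-1)^{|i||j|}v_j\otimes v_i$ if $i<j$; $(-1)^{|i||j|}v_j\otimes v_i+(q^{-1}-q)v_i\otimes v_j$ if $i>j$. Negative $\alpha$–$\alpha$ crossing: $v_i\otimes v_j\mapsto q\,v_i\otimes v_i$ if $i=j\le m$; $-q^{-1}v_i\otimes v_i$ if $i=j>m$; $(-1)^{|i||j|}v_j\otimes v_i+(q-q^{-1})v_i\otimes v_j$ if $i<j$; $(-1)^{|i||j|}v_j\otimes v_i$ if $i>j$. Virtual $\alpha$–$\alpha$ crossing: $v_i\otimes v_j\mapsto c_{ij}\,v_j\otimes v_i$ with $c_{ij}=1$ if $i,j\le m$; $q$ if $j\le m<i$; $q^{-1}$ if $i\le m<j$; $-1$ if $i,j>m$. $\alpha$-colored cups: $1\mapsto\sum_k v_k\otimes v_k^*$ and $1\mapsto q^{m-n}\bigl(\sum_{k=1}^m q^{1-2k}v_k^*\otimes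 v_k-\sum_{k=m+1}^{m+n}q^{-4m-1+2k}v_k^*\otimes v_k\bigr)$. $\alpha$-colored caps: $v_k^*\otimes v_l\mapsto\delta_{kl}$, and $v_k\otimes v_l^*\mapsto\delta_{kl}q^{-m+n-1+2k}$ if $k\le m$, $\mapsto-\delta_{kl}q^{3m+n+1-2k}$ if $k>m$. A positive (resp. negative) crossing of a $z$-colored strand over an $\alpha$-strand, $z\in\Omega$: under $\mathbb F\otimes V\cong V\cong V\otimes\mathbb F$, the map $V\to V$ that fixes $v_i$ for $i\le m$ and multiplies $v_i$ for $i>m$ by $z^{-1}$ (resp. by $z$). Virtual crossings involving an $\Omega$-colored strand, and $\Omega$-colored cups and caps: the canonical isomorphisms. A slice $\mathrm{id}\otimes e\otimes\mathrm{id}$ goes to the corresponding tensor product of maps, and a diagram to the composition of the values of its slices. **Theorem.** For all $m,n\ge 0$, the assignment $\widetilde Q^{m|n}_\Omega$ is invariant under the moves (i)–(iv), so it induces a unique well-defined functor $\widetilde Q^{m|n}_\Omega:\mathcal{PT}^{fr,rot}_\Omega\to\mathbf{Vect}_{\mathbb F}$; in particular it respects the $\Omega$-semi-welded and $\Omega$-commutator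 moves. If $m=n=1$ and $S,T$ are diagrams that represent the same morphism of $\mathcal{PT}_\Omega$, then $\widetilde Q^{1|1}_\Omega(S)=q^k\,\widetilde Q^{1|1}_\Omega(T)$ for some $k\in\mathbb Z$. -/

import Mathlib

open CategoryTheory MonoidalCategory
open scoped TensorProduct

namespace Prismatic

/-! ### Prismatic tangle diagrams -/

/-- The symplectic palette `Ω = {x₁, y₁, …, x_g, y_g}`. -/
inductive Palette (g : ℕ) : Type
  | x (i : Fin g)
  | y (i : Fin g)

/-- The colours `{α} ∪ Ω`. -/
inductive Color (g : ℕ) : Type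
  | alpha
  | om (z : Palette g)

/-- The symbols of which objects are sequences: `up c` is the symbol `⊞` in colour `c` (a strand
oriented upwards), `dn c` is the symbol `⊟` in colour `c` (a strand oriented downwards). -/
inductive Letter (g : ℕ) : Type
  | up (c : Color g)
  | dn (c : Color g)

open Palette Color Letter

/-- The letter of colour `c` with orientation `s` (`true` is upwards). -/
def ltr {g : ℕ} (c : Color g) : Bool → Letter g
  | true => up c
  | false => dn c

/-- The elementary coloured tangles, read from bottom to top. In every classical crossing the
under-crossing strand has colour `α`; the over-crossing strand may have any colour `c`.
Both strands of an elementary crossing are oriented upwards. -/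
inductive Elem (g : ℕ) : List (Letter g) → List (Letter g) → Type
  /-- positive crossing: the over-strand goes from bottom left to top right -/
  | pos (c : Color g) : Elem g [up c, up alpha] [up alpha, up c]
  /-- negative crossing: the over-strand goes from bottom right to top left -/
  | neg (c : Color g) : Elem g [up alpha, up c] [up c, up alpha]
  /-- virtual crossing of strands of any colours -/
  | virt (c d : Color g) : Elem g [up c, up d] [up d, up c]
  /-- the two cups -/
  | cupL (c : Color g) : Elem g [] [up c, dn c]
  | cupR (c : Color g) : Elem g [] [dn c, up c]
  /-- the two caps -/
  | capL (c : Color g) : Elem g [dn c, up c] []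
  | capR (c : Color g) : Elem g [up c, dn c] []

/-- A horizontal slice of a diagram: `id_l ⊗ e ⊗ id_r` with exactly one elementary tangle `e`.
`here e r` is `e ⊗ id_r`, and `there a L` is `id_a ⊗ L`. -/
inductive Layer (g : ℕ) : List (Letter g) → List (Letter g) → Type
  | here {s t : List (Letter g)} (e : Elem g s t) (r : List (Letter g)) : Layer g (s ++ r) (t ++ r)
  | there (a : Letter g) {s t : List (Letter g)} (L : Layer g s t) : Layer g (a :: s) (a :: t)

/-- An `Ω`-prismatic tangle diagram (in general position with respect to the height function),
as the bottom-to-top sequence of its slices. -/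
inductive Diagram (g : ℕ) : List (Letter g) → List (Letter g) → Type
  | nil (s : List (Letter g)) : Diagram g s s
  | cons {s t u : List (Letter g)} (L : Layer g s t) (T : Diagram g t u) : Diagram g s u

variable {g : ℕ}

/-- Stacking: `S.comp T` is `S` at the bottom followed by `T` on top of it. -/
def Diagram.comp {s t u : List (Letter g)} : Diagram g s t → Diagram g t u → Diagram g s u
  | .nil _, T => T
  | .cons L S, T => .cons L (S.comp T)

theorem Diagram.comp_nil {s t : List (Letter g)} (S : Diagram g s t) : S.comp (.nil t) = S := by
  induction S with
  | nil s => rfl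
  | cons L S ih => simp [Diagram.comp, ih]

theorem Diagram.comp_assoc {s t u v : List (Letter g)} (S : Diagram g s t) (T : Diagram g t u)
    (U : Diagram g u v) : (S.comp T).comp U = S.comp (T.comp U) := by
  induction S with
  | nil s => rfl
  | cons L S ih => simp [Diagram.comp, ih]

/-- `id_a ⊗ T`. -/
def Diagram.left (a : Letter g) {s t : List (Letter g)} :
    Diagram g s t → Diagram g (a :: s) (a :: t)
  | .nil s => .nil (a :: s)
  | .cons L T => .cons (.there a L) (T.left a)

/-- `id_l ⊗ L` for a slice `L`. -/
def Layer.lefts {s t : List (Letter g)} (L : Layer g s t) :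
    (l : List (Letter g)) → Layer g (l ++ s) (l ++ t)
  | [] => L
  | a :: l => .there a (L.lefts l)

/-- The category of diagrams, before any moves are imposed: objects are the coloured sequences. -/
structure DiagObj (g : ℕ) : Type where
  word : List (Letter g)

instance : Category (DiagObj g) where
  Hom a b := Diagram g a.word b.word
  id a := .nil a.word
  comp S T := S.comp T
  id_comp _ := rfl
  comp_id S := S.comp_nil
  assoc S T U := S.comp_assoc T U

/-! ### Crossings of arbitrary orientation -/

section Rotations

variable {a b : Color g}

/-- The crossing `f` with its right-hand incoming strand reversed. -/
def sideL (f : Elem g [up a, up b] [up b, up a]) (r : List (Letter g)) :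
    Diagram g (dn b :: up a :: r) (up a :: dn b :: r) :=
  .cons (.there (dn b) (.there (up a) (.here (.cupL b) r))) <|
  .cons (.there (dn b) (.here f (dn b :: r))) <|
  .cons (.here (.capL b) (up a :: dn b :: r)) <| .nil _

/-- The crossing `f` with its left-hand incoming strand reversed. -/
def sideR (f : Elem g [up a, up b] [up b, up a]) (r : List (Letter g)) :
    Diagram g (up b :: dn a :: r) (dn a :: up b :: r) :=
  .cons (.here (.cupR a) (up b :: dn a :: r)) <|
  .cons (.there (dn a) (.here f (dn a :: r))) <|
  .cons (.there (dn a) (.there (up b) (.here (.capR a) r))) <| .nil _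

/-- The crossing `f` with both strands reversed (rotated by a half turn in one direction). -/
def rotL (f : Elem g [up a, up b] [up b, up a]) (r : List (Letter g)) :
    Diagram g (dn a :: dn b :: r) (dn b :: dn a :: r) :=
  .cons (.there (dn a) (.there (dn b) (.here (.cupL a) r))) <|
  .cons (.there (dn a) (.there (dn b) (.there (up a) (.here (.cupL b) (dn a :: r))))) <|
  .cons (.there (dn a) (.there (dn b) (.here f (dn b :: dn a :: r)))) <|
  .cons (.there (dn a) (.here (.capL b) (up a :: dn b :: dn a :: r))) <|
  .cons (.here (.capL a) (dn b :: dn a :: r)) <| .nil _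

/-- The crossing `f` with both strands reversed (rotated by a half turn in the other direction). -/
def rotR (f : Elem g [up a, up b] [up b, up a]) (r : List (Letter g)) :
    Diagram g (dn a :: dn b :: r) (dn b :: dn a :: r) :=
  .cons (.here (.cupR b) (dn a :: dn b :: r)) <|
  .cons (.there (dn b) (.here (.cupR a) (up b :: dn a :: dn b :: r))) <|
  .cons (.there (dn b) (.there (dn a) (.here f (dn a :: dn b :: r)))) <|
  .cons (.there (dn b) (.there (dn a) (.there (up b) (.here (.capR a) (dn b :: r))))) <|
  .cons (.there (dn b) (.there (dn a) (.here (.capR b) r))) <| .nil _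

/-- The crossing of a strand of colour `a` and orientation `s`, entering at the bottom left, with a
strand of colour `b` and orientation `t`, entering at the bottom right, obtained by rotating the
upward crossing `f`, or the upward crossing `f'` with the strands in the opposite order. -/
def orient (f : Elem g [up a, up b] [up b, up a]) (f' : Elem g [up b, up a] [up a, up b]) :
    (s t : Bool) → (r : List (Letter g)) →
      Diagram g (ltr a s :: ltr b t :: r) (ltr b t :: ltr a s :: r)
  | true, true, r => .cons (.here f r) (.nil _)
  | true, false, r => sideR f' r
  | false, true, r => sideL f' r
  | false, false, r => rotL f r

/-- The `α`-strand of orientation `s` at the bottom left passes under a `z`-coloured strand of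
orientation `t`. -/
def underOne (z : Palette g) (s t : Bool) (r : List (Letter g)) :
    Diagram g (ltr alpha s :: ltr (om z) t :: r) (ltr (om z) t :: ltr alpha s :: r) :=
  orient (.neg (om z)) (.pos (om z)) s t r

/-- The `α`-strand of orientation `s` at the bottom left crosses a `z`-coloured strand of
orientation `t` virtually. -/
def virtOne (z : Palette g) (s t : Bool) (r : List (Letter g)) :
    Diagram g (ltr alpha s :: ltr (om z) t :: r) (ltr (om z) t :: ltr alpha s :: r) :=
  orient (.virt alpha (om z)) (.virt (om z) alpha) s t r

/-- The sequence of letters of a family of parallel `Ω`-coloured strands. -/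
def strands (ws : List (Palette g × Bool)) (r : List (Letter g)) : List (Letter g) :=
  match ws with
  | [] => r
  | w :: ws => ltr (om w.1) w.2 :: strands ws r

/-- An `α`-strand passes from left to right under all the `Ω`-strands `ws`. -/
def underAll (s : Bool) (r : List (Letter g)) : (ws : List (Palette g × Bool)) →
    Diagram g (ltr alpha s :: strands ws r) (strands ws (ltr alpha s :: r))
  | [] => .nil _
  | w :: ws => (underOne w.1 s w.2 (strands ws r)).comp
      ((underAll s r ws).left (ltr (om w.1) w.2))

/-- An `α`-strand passes from left to right virtually across all the `Ω`-strands `ws`. -/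
def virtAll (s : Bool) (r : List (Letter g)) : (ws : List (Palette g × Bool)) →
    Diagram g (ltr alpha s :: strands ws r) (strands ws (ltr alpha s :: r))
  | [] => .nil _
  | w :: ws => (virtOne w.1 s w.2 (strands ws r)).comp
      ((virtAll s r ws).left (ltr (om w.1) w.2))

/-- The over-crossing arcs of the commutator move, from left to right: for `i = 1, …, g` the arcs
`x_i` up, `y_i` up, `x_i` down, `y_i` down. -/
def commWord (g : ℕ) : List (Palette g × Bool) :=
  (List.finRange g).flatMap fun i => [(x i, true), (y i, true), (x i, false), (y i, false)]

/-- A curl to the right of an upward strand of colour `a` with self-crossing `f`. -/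
def curlR (f : Elem g [up a, up a] [up a, up a]) (r : List (Letter g)) :
    Diagram g (up a :: r) (up a :: r) :=
  .cons (.there (up a) (.here (.cupL a) r)) <|
  .cons (.here f (dn a :: r)) <|
  .cons (.there (up a) (.here (.capR a) r)) <| .nil _

/-- A curl to the left of an upward strand of colour `a` with self-crossing `f`. -/
def curlL (f : Elem g [up a, up a] [up a, up a]) (r : List (Letter g)) :
    Diagram g (up a :: r) (up a :: r) :=
  .cons (.here (.cupR a) (up a :: r)) <|
  .cons (.there (dn a) (.here f r)) <|
  .cons (.here (.capL a) (up a :: r)) <| .nil _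

/-- The curl on the right (`true`) or on the left (`false`). -/
def curl (f : Elem g [up a, up a] [up a, up a]) : Bool → (r : List (Letter g)) →
    Diagram g (up a :: r) (up a :: r)
  | true, r => curlR f r
  | false, r => curlL f r

end Rotations

/-- A crossing together with the crossing that undoes it. -/
inductive InvPair : (a b : Color g) → Elem g [up a, up b] [up b, up a] →
    Elem g [up b, up a] [up a, up b] → Prop
  | posNeg (c : Color g) : InvPair c alpha (.pos c) (.neg c)
  | negPos (c : Color g) : InvPair alpha c (.neg c) (.pos c)
  | virt (c d : Color g) : InvPair c d (.virt c d) (.virt d c)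

/-! ### Moves

All moves are local: `r` is the sequence of vertical strands to the right of the picture, and
strands to the left are added in `LeftClosure`. -/

/-- A family of pairs of diagrams with common domain and codomain. -/
abbrev MoveFamily (g : ℕ) := ∀ s t : List (Letter g), Diagram g s t → Diagram g s t → Prop

/-- Isotopies of the plane, the second Reidemeister moves (classical and virtual, with parallel and
with antiparallel strands), the third Reidemeister moves (classical, virtual and mixed), and
cancellation of classical curls of opposite signs on the `α`-part. -/
inductive TangleMove : MoveFamily g
  /-- far-apart slices can be exchanged -/
  | interchange {s t u v : List (Letter g)} (e : Elem g s t) (L : Layer g u v) :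
      TangleMove _ _
        (.cons (.here e u) (.cons (L.lefts t) (.nil _)))
        (.cons (L.lefts s) (.cons (.here e v) (.nil _)))
  /-- straightening a strand -/
  | zigzag₁ (c : Color g) (r : List (Letter g)) :
      TangleMove (up c :: r) (up c :: r)
        (.cons (.here (.cupL c) (up c :: r)) (.cons (.there (up c) (.here (.capL c) r)) (.nil _)))
        (.nil _)
  | zigzag₂ (c : Color g) (r : List (Letter g)) :
      TangleMove (up c :: r) (up c :: r)
        (.cons (.there (up c) (.here (.cupR c) r)) (.cons (.here (.capR c) (up c :: r)) (.nil _)))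
        (.nil _)
  | zigzag₃ (c : Color g) (r : List (Letter g)) :
      TangleMove (dn c :: r) (dn c :: r)
        (.cons (.there (dn c) (.here (.cupL c) r)) (.cons (.here (.capL c) (dn c :: r)) (.nil _)))
        (.nil _)
  | zigzag₄ (c : Color g) (r : List (Letter g)) :
      TangleMove (dn c :: r) (dn c :: r)
        (.cons (.here (.cupR c) (dn c :: r)) (.cons (.there (dn c) (.here (.capR c) r)) (.nil _)))
        (.nil _)
  /-- rotating a crossing by a half turn in either direction gives the same result -/
  | rotate {a b : Color g} {f : Elem g [up a, up b] [up b, up a]}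
      {f' : Elem g [up b, up a] [up a, up b]} (h : InvPair a b f f') (r : List (Letter g)) :
      TangleMove (dn a :: dn b :: r) (dn b :: dn a :: r) (rotL f r) (rotR f r)
  /-- second Reidemeister move, parallel strands -/
  | r2 {a b : Color g} {f : Elem g [up a, up b] [up b, up a]}
      {f' : Elem g [up b, up a] [up a, up b]} (h : InvPair a b f f') (r : List (Letter g)) :
      TangleMove (up a :: up b :: r) (up a :: up b :: r)
        (.cons (.here f r) (.cons (.here f' r) (.nil _))) (.nil _)
  /-- second Reidemeister move, antiparallel strands -/
  | r2anti₁ {a b : Color g} {f : Elem g [up a, up b] [up b, up a]}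
      {f' : Elem g [up b, up a] [up a, up b]} (h : InvPair a b f f') (r : List (Letter g)) :
      TangleMove (dn b :: up a :: r) (dn b :: up a :: r) ((sideL f r).comp (sideR f' r)) (.nil _)
  | r2anti₂ {a b : Color g} {f : Elem g [up a, up b] [up b, up a]}
      {f' : Elem g [up b, up a] [up a, up b]} (h : InvPair a b f f') (r : List (Letter g)) :
      TangleMove (up a :: dn b :: r) (up a :: dn b :: r) ((sideR f' r).comp (sideL f r)) (.nil _)
  /-- third Reidemeister move; the top strand has any colour -/
  | r3 (c : Color g) (r : List (Letter g)) :
      TangleMove (up c :: up alpha :: up alpha :: r) (up alpha :: up alpha :: up c :: r)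
        (.cons (.here (.pos c) (up alpha :: r)) <|
          .cons (.there (up alpha) (.here (.pos c) r)) <|
          .cons (.here (.pos alpha) (up c :: r)) <| .nil _)
        (.cons (.there (up c) (.here (.pos alpha) r)) <|
          .cons (.here (.pos c) (up alpha :: r)) <|
          .cons (.there (up alpha) (.here (.pos c) r)) <| .nil _)
  /-- virtual third Reidemeister move -/
  | v3 (a b c : Color g) (r : List (Letter g)) :
      TangleMove (up a :: up b :: up c :: r) (up c :: up b :: up a :: r)
        (.cons (.here (.virt a b) (up c :: r)) <|
          .cons (.there (up b) (.here (.virt a c) r)) <|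
          .cons (.here (.virt b c) (up a :: r)) <| .nil _)
        (.cons (.there (up a) (.here (.virt b c) r)) <|
          .cons (.here (.virt a c) (up b :: r)) <|
          .cons (.there (up c) (.here (.virt a b) r)) <| .nil _)
  /-- mixed third Reidemeister move: a strand crosses virtually past a classical crossing -/
  | mixed (c e : Color g) (r : List (Letter g)) :
      TangleMove (up c :: up alpha :: up e :: r) (up e :: up alpha :: up c :: r)
        (.cons (.here (.pos c) (up e :: r)) <|
          .cons (.there (up alpha) (.here (.virt c e) r)) <|
          .cons (.here (.virt alpha e) (up c :: r)) <| .nil _)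
        (.cons (.there (up c) (.here (.virt alpha e) r)) <|
          .cons (.here (.virt c e) (up alpha :: r)) <|
          .cons (.there (up e) (.here (.pos c) r)) <| .nil _)
  /-- classical curls of opposite signs cancel, in either order and on any sides -/
  | framed₁ (s t : Bool) (r : List (Letter g)) :
      TangleMove (up alpha :: r) (up alpha :: r)
        ((curl (.pos alpha) s r).comp (curl (.neg alpha) t r)) (.nil _)
  | framed₂ (s t : Bool) (r : List (Letter g)) :
      TangleMove (up alpha :: r) (up alpha :: r)
        ((curl (.neg alpha) s r).comp (curl (.pos alpha) t r)) (.nil _)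

/-- The `Ω`-semi-welded move: a `z`-coloured strand, `z ∈ Ω`, that passes over two `α`-strands is
moved across a virtual crossing of these two strands. -/
inductive SemiWeldedMove : MoveFamily g
  | intro (z : Palette g) (r : List (Letter g)) :
      SemiWeldedMove (up (om z) :: up alpha :: up alpha :: r)
        (up alpha :: up alpha :: up (om z) :: r)
        (.cons (.here (.pos (om z)) (up alpha :: r)) <|
          .cons (.there (up alpha) (.here (.pos (om z)) r)) <|
          .cons (.here (.virt alpha alpha) (up (om z) :: r)) <| .nil _)
        (.cons (.there (up (om z)) (.here (.virt alpha alpha) r)) <|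
          .cons (.here (.pos (om z)) (up alpha :: r)) <|
          .cons (.there (up alpha) (.here (.pos (om z)) r)) <| .nil _)

/-- The `Ω`-commutator move: an `α`-strand (of either orientation) that passes under the strands
`x_i` up, `y_i` up, `x_i` down, `y_i` down for `i = 1, …, g` is released from all of them. -/
inductive CommutatorMove : MoveFamily g
  | intro (s : Bool) (r : List (Letter g)) :
      CommutatorMove (ltr alpha s :: strands (commWord g) r) (strands (commWord g) (ltr alpha s :: r))
        (underAll s r (commWord g)) (virtAll s r (commWord g))

/-- First virtual Reidemeister move on strands whose colour satisfies `p`. -/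
inductive VirtualCurlMove (p : Color g → Prop) : MoveFamily g
  | intro (c : Color g) (h : p c) (side : Bool) (r : List (Letter g)) :
      VirtualCurlMove p (up c :: r) (up c :: r) (curl (.virt c c) side r) (.nil _)

/-- First classical Reidemeister move (on the `α`-part; classical self-crossings of the `Ω`-part
do not exist). -/
inductive ClassicalCurlMove : MoveFamily g
  | pos (side : Bool) (r : List (Letter g)) :
      ClassicalCurlMove (up alpha :: r) (up alpha :: r) (curl (.pos alpha) side r) (.nil _)
  | neg (side : Bool) (r : List (Letter g)) :
      ClassicalCurlMove (up alpha :: r) (up alpha :: r) (curl (.neg alpha) side r) (.nil _)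

/-- Closing a family of moves under adding vertical strands on the left. -/
inductive LeftClosure (R : MoveFamily g) : MoveFamily g
  | base {s t : List (Letter g)} {S T : Diagram g s t} : R s t S T → LeftClosure R s t S T
  | left (a : Letter g) {s t : List (Letter g)} {S T : Diagram g s t} :
      LeftClosure R s t S T → LeftClosure R (a :: s) (a :: t) (S.left a) (T.left a)

/-- The moves of framed rotational prismatic tangles. On the `Ω`-part the first virtual Reidemeister
move is allowed; on the `α`-part neither first Reidemeister move is. -/
def frRotMoves : MoveFamily g := fun s t S T =>
  TangleMove s t S T ∨ SemiWeldedMove s t S T ∨ CommutatorMove s t S T ∨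
    VirtualCurlMove (fun c => c ≠ alpha) s t S T

/-- The moves of (unframed, non-rotational) prismatic tangles. -/
def allMoves : MoveFamily g := fun s t S T =>
  frRotMoves s t S T ∨ ClassicalCurlMove s t S T ∨ VirtualCurlMove (fun _ => True) s t S T

/-- A family of local moves as a relation on the morphisms of the category of diagrams. -/
def MoveFamily.homRel (R : MoveFamily g) : HomRel (DiagObj g) :=
  fun a b S T => LeftClosure R a.word b.word S T

/-- The category of framed rotational `Ω`-prismatic tangles: diagrams modulo the equivalence relation
generated by performing the moves anywhere in a diagram. -/
abbrev PTfrRot (g : ℕ) := CategoryTheory.Quotient (MoveFamily.homRel (frRotMoves (g := g)))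

/-- The category of `Ω`-prismatic tangles. -/
abbrev PT (g : ℕ) := CategoryTheory.Quotient (MoveFamily.homRel (allMoves (g := g)))

/-! ### The Reshetikhin–Turaev assignment -/

noncomputable section

/-- The field `𝔽 = ℂ(q, x₁, y₁, …, x_g, y_g)`; the variable `none` is `q`. -/
abbrev K (g : ℕ) : Type := FractionRing (MvPolynomial (Option (Palette g)) ℂ)

/-- The variable `q`. -/
def q : K g := algebraMap (MvPolynomial (Option (Palette g)) ℂ) (K g) (MvPolynomial.X none)

/-- The variable `z`, for `z ∈ Ω`. -/
def var (z : Palette g) : K g :=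
  algebraMap (MvPolynomial (Option (Palette g)) ℂ) (K g) (MvPolynomial.X (some z))

variable (m n : ℕ)

/-- The underlying space of the vector representation, with basis `x₁, …, x_{m+n}`. -/
abbrev V (m n g : ℕ) : Type := Fin (m + n) → K g

/-- The dual space. -/
abbrev Vd (m n g : ℕ) : Type := Module.Dual (K g) (V m n g)

/-- The basis `x₁, …, x_{m+n}`, numbered from `0` here. -/
def vb (g : ℕ) : Module.Basis (Fin (m + n)) (K g) (V m n g) := Pi.basisFun (K g) (Fin (m + n))

/-- The dual basis `x₁^*, …, x_{m+n}^*`. -/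
def db (g : ℕ) : Module.Basis (Fin (m + n)) (K g) (Vd m n g) := (vb m n g).dualBasis

variable {m n}

/-- The parity of a basis vector: `0` for the first `m`, and `1` for the last `n`. -/
def par (i : Fin (m + n)) : ℕ := if i.val < m then 0 else 1

variable (m n)

/-- The value of the positive classical crossing of two `α`-strands. -/
def posMap : V m n g ⊗[K g] V m n g →ₗ[K g] V m n g ⊗[K g] V m n g :=
  ((vb m n g).tensorProduct (vb m n g)).constr (K g) fun p =>
    let i := p.1
    let j := p.2
    if i = j then
      (if i.val < m then (q : K g)⁻¹ • (vb m n g i ⊗ₜ[K g] vb m n g i) else (-q : K g) • (vb m n g i ⊗ₜ[K g] vb m n g i))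
    else if i < j then (-1 : K g) ^ (par i * par j) • (vb m n g j ⊗ₜ[K g] vb m n g i)
    else (-1 : K g) ^ (par i * par j) • (vb m n g j ⊗ₜ[K g] vb m n g i) +
      (q⁻¹ - q : K g) • (vb m n g i ⊗ₜ[K g] vb m n g j)

/-- The value of the negative classical crossing of two `α`-strands. -/
def negMap : V m n g ⊗[K g] V m n g →ₗ[K g] V m n g ⊗[K g] V m n g :=
  ((vb m n g).tensorProduct (vb m n g)).constr (K g) fun p =>
    let i := p.1
    let j := p.2
    if i = j then
      (if i.val < m then (q : K g) • (vb m n g i ⊗ₜ[K g] vb m n g i) else (-q⁻¹ : K g) • (vb m n g i ⊗ₜ[K g] vb m n g i))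
    else if i < j then (-1 : K g) ^ (par i * par j) • (vb m n g j ⊗ₜ[K g] vb m n g i) +
      (q - q⁻¹ : K g) • (vb m n g i ⊗ₜ[K g] vb m n g j)
    else (-1 : K g) ^ (par i * par j) • (vb m n g j ⊗ₜ[K g] vb m n g i)

/-- The value of the virtual crossing of two `α`-strands. -/
def virtMap : V m n g ⊗[K g] V m n g →ₗ[K g] V m n g ⊗[K g] V m n g :=
  ((vb m n g).tensorProduct (vb m n g)).constr (K g) fun p =>
    let i := p.1
    let j := p.2
    (if i.val < m then (if j.val < m then (1 : K g) else q⁻¹)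
      else (if j.val < m then q else -1)) • (vb m n g j ⊗ₜ[K g] vb m n g i)

/-- `1 ↦ ∑ x_k ⊗ x_k^*`. -/
def cupLMap : K g →ₗ[K g] V m n g ⊗[K g] Vd m n g :=
  LinearMap.toSpanSingleton (K g) _ (∑ k, vb m n g k ⊗ₜ[K g] db m n g k)

/-- `1 ↦ q^{m-n} (∑_{k ≤ m} q^{1-2k} x_k^* ⊗ x_k - ∑_{k > m} q^{-4m-1+2k} x_k^* ⊗ x_k)`,
where the number `k` of a basis vector is `k.val + 1`. -/
def cupRMap : K g →ₗ[K g] Vd m n g ⊗[K g] V m n g :=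
  LinearMap.toSpanSingleton (K g) _ ((q : K g) ^ ((m : ℤ) - n) • ∑ k : Fin (m + n),
    (if k.val < m then (q : K g) ^ (1 - 2 * ((k.val : ℤ) + 1))
      else -(q : K g) ^ (-4 * (m : ℤ) - 1 + 2 * ((k.val : ℤ) + 1))) •
        (db m n g k ⊗ₜ[K g] vb m n g k))

/-- `x_k^* ⊗ x_k ↦ 1`: the evaluation map. -/
def capLMap : Vd m n g ⊗[K g] V m n g →ₗ[K g] K g := contractLeft (K g) (V m n g)

/-- `x_k ⊗ x_k^* ↦ q^{-m+n-1+2k}` if `k ≤ m`, and `↦ -q^{3m+n+1-2k}` if `k > m`, where the number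
`k` of a basis vector is `k.val + 1`; `x_k ⊗ x_l^* ↦ 0` if `k ≠ l`. -/
def capRMap : V m n g ⊗[K g] Vd m n g →ₗ[K g] K g :=
  ((vb m n g).tensorProduct (db m n g)).constr (K g) fun p =>
    if p.1 = p.2 then
      (if p.1.val < m then (q : K g) ^ (-(m : ℤ) + n - 1 + 2 * ((p.1.val : ℤ) + 1))
        else -(q : K g) ^ (3 * (m : ℤ) + n + 1 - 2 * ((p.1.val : ℤ) + 1)))
    else 0

/-- Multiplication of the odd part of the vector representation by a scalar. -/
def oddMul (a : K g) : V m n g →ₗ[K g] V m n g :=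
  (vb m n g).constr (K g) fun i => if i.val < m then vb m n g i else a • vb m n g i

/-- The swap `𝔽 ⊗ M ≅ M ≅ M ⊗ 𝔽`. -/
def unitLeft (M : Type) [AddCommGroup M] [Module (K g) M] :
    K g ⊗[K g] M →ₗ[K g] M ⊗[K g] K g :=
  ((TensorProduct.lid (K g) M).trans (TensorProduct.rid (K g) M).symm).toLinearMap

/-- The swap `M ⊗ 𝔽 ≅ M ≅ 𝔽 ⊗ M`. -/
def unitRight (M : Type) [AddCommGroup M] [Module (K g) M] :
    M ⊗[K g] K g →ₗ[K g] K g ⊗[K g] M :=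
  ((TensorProduct.rid (K g) M).trans (TensorProduct.lid (K g) M).symm).toLinearMap

/-- The value of a positive crossing of a `z`-coloured strand over an `α`-strand: `x_i ↦ x_i` if
`i ≤ m` and `x_i ↦ z⁻¹ x_i` if `i > m`. -/
def overPos (z : Palette g) : K g ⊗[K g] V m n g →ₗ[K g] V m n g ⊗[K g] K g :=
  (TensorProduct.rid (K g) (V m n g)).symm.toLinearMap ∘ₗ oddMul m n (var z)⁻¹ ∘ₗ
    (TensorProduct.lid (K g) (V m n g)).toLinearMap

/-- The value of a negative crossing of a `z`-coloured strand over an `α`-strand: `x_i ↦ x_i` if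
`i ≤ m` and `x_i ↦ z x_i` if `i > m`. -/
def overNeg (z : Palette g) : V m n g ⊗[K g] K g →ₗ[K g] K g ⊗[K g] V m n g :=
  (TensorProduct.lid (K g) (V m n g)).symm.toLinearMap ∘ₗ oddMul m n (var z) ∘ₗ
    (TensorProduct.rid (K g) (V m n g)).toLinearMap

/-- The space of a letter: the vector representation or its dual for the colour `α`, and a
one-dimensional space for the colours of `Ω`. -/
def Qletter : Letter g → ModuleCat.{0} (K g)
  | up alpha => ModuleCat.of (K g) (V m n g)
  | dn alpha => ModuleCat.of (K g) (Vd m n g)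
  | up (om _) => ModuleCat.of (K g) (K g)
  | dn (om _) => ModuleCat.of (K g) (K g)

/-- The space of an object: the tensor product of the spaces of its letters. -/
def Qobj : List (Letter g) → ModuleCat.{0} (K g)
  | [] => ModuleCat.of (K g) (K g)
  | a :: s => Qletter m n a ⊗ Qobj s

/-- Positive crossings. -/
def Qpos : (c : Color g) →
    (Qletter m n (up c) ⊗ Qletter m n (up alpha) ⟶ Qletter m n (up alpha) ⊗ Qletter m n (up c))
  | alpha => ModuleCat.ofHom (posMap m n)
  | om z => ModuleCat.ofHom (overPos m n z)

/-- Negative crossings. -/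
def Qneg : (c : Color g) →
    (Qletter m n (up alpha) ⊗ Qletter m n (up c) ⟶ Qletter m n (up c) ⊗ Qletter m n (up alpha))
  | alpha => ModuleCat.ofHom (negMap m n)
  | om z => ModuleCat.ofHom (overNeg m n z)

/-- Virtual crossings. -/
def Qvirt : (c d : Color g) →
    (Qletter m n (up c) ⊗ Qletter m n (up d) ⟶ Qletter m n (up d) ⊗ Qletter m n (up c))
  | alpha, alpha => ModuleCat.ofHom (virtMap m n)
  | om _, alpha => ModuleCat.ofHom (unitLeft (V m n g))
  | alpha, om _ => ModuleCat.ofHom (unitRight (V m n g))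
  | om _, om _ => ModuleCat.ofHom LinearMap.id

/-- Cups. -/
def QcupL : (c : Color g) →
    (ModuleCat.of (K g) (K g) ⟶ Qletter m n (up c) ⊗ Qletter m n (dn c))
  | alpha => ModuleCat.ofHom (cupLMap m n)
  | om _ => ModuleCat.ofHom (TensorProduct.lid (K g) (K g)).symm.toLinearMap

def QcupR : (c : Color g) →
    (ModuleCat.of (K g) (K g) ⟶ Qletter m n (dn c) ⊗ Qletter m n (up c))
  | alpha => ModuleCat.ofHom (cupRMap m n)
  | om _ => ModuleCat.ofHom (TensorProduct.lid (K g) (K g)).symm.toLinearMap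

/-- Caps. -/
def QcapL : (c : Color g) →
    (Qletter m n (dn c) ⊗ Qletter m n (up c) ⟶ ModuleCat.of (K g) (K g))
  | alpha => ModuleCat.ofHom (capLMap m n)
  | om _ => ModuleCat.ofHom (TensorProduct.lid (K g) (K g)).toLinearMap

def QcapR : (c : Color g) →
    (Qletter m n (up c) ⊗ Qletter m n (dn c) ⟶ ModuleCat.of (K g) (K g))
  | alpha => ModuleCat.ofHom (capRMap m n)
  | om _ => ModuleCat.ofHom (TensorProduct.lid (K g) (K g)).toLinearMap

variable {m n}

/-- `f ⊗ id_M` with right-associated tensor products. -/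
def onTwo {A B C D : ModuleCat.{0} (K g)} (f : A ⊗ B ⟶ C ⊗ D) (M : ModuleCat.{0} (K g)) :
    A ⊗ (B ⊗ M) ⟶ C ⊗ (D ⊗ M) :=
  (α_ A B M).inv ≫ f ▷ M ≫ (α_ C D M).hom

def onCup {A B : ModuleCat.{0} (K g)} (f : ModuleCat.of (K g) (K g) ⟶ A ⊗ B)
    (M : ModuleCat.{0} (K g)) : M ⟶ A ⊗ (B ⊗ M) :=
  (λ_ M).inv ≫ f ▷ M ≫ (α_ A B M).hom

def onCap {A B : ModuleCat.{0} (K g)} (f : A ⊗ B ⟶ ModuleCat.of (K g) (K g))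
    (M : ModuleCat.{0} (K g)) : A ⊗ (B ⊗ M) ⟶ M :=
  (α_ A B M).inv ≫ f ▷ M ≫ (λ_ M).hom

variable (m n)

/-- The value of `e ⊗ id_r` for an elementary tangle `e`. -/
def Qelem : {s t : List (Letter g)} → Elem g s t → (r : List (Letter g)) →
    (Qobj m n (s ++ r) ⟶ Qobj m n (t ++ r))
  | _, _, .pos c, r => onTwo (Qpos m n c) (Qobj m n r)
  | _, _, .neg c, r => onTwo (Qneg m n c) (Qobj m n r)
  | _, _, .virt c d, r => onTwo (Qvirt m n c d) (Qobj m n r)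
  | _, _, .cupL c, r => onCup (QcupL m n c) (Qobj m n r)
  | _, _, .cupR c, r => onCup (QcupR m n c) (Qobj m n r)
  | _, _, .capL c, r => onCap (QcapL m n c) (Qobj m n r)
  | _, _, .capR c, r => onCap (QcapR m n c) (Qobj m n r)

/-- The value of a slice. -/
def Qlayer : {s t : List (Letter g)} → Layer g s t → (Qobj m n s ⟶ Qobj m n t)
  | _, _, .here e r => Qelem m n e r
  | _, _, .there a L => Qletter m n a ◁ Qlayer L

/-- The value of a diagram. -/
def Qmap : {s t : List (Letter g)} → Diagram g s t → (Qobj m n s ⟶ Qobj m n t)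
  | _, _, .nil s => 𝟙 (Qobj m n s)
  | _, _, .cons L T => Qlayer m n L ≫ Qmap T

theorem Qmap_comp {s t u : List (Letter g)} (S : Diagram g s t) (T : Diagram g t u) :
    Qmap m n (S.comp T) = Qmap m n S ≫ Qmap m n T := by
  induction S with
  | nil s => simp [Diagram.comp, Qmap]
  | cons L S ih => simp [Diagram.comp, Qmap, ih]

/-- The prismatic Reshetikhin–Turaev assignment, as a functor on the category of diagrams. -/
def Qdiag (g : ℕ) : DiagObj g ⥤ ModuleCat.{0} (K g) where
  obj a := Qobj m n a.word
  map S := Qmap m n S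
  map_id _ := rfl
  map_comp S T := Qmap_comp m n S T

end

end Prismatic

/-! Each move is an identity of linear maps, checked on basis vectors of the two or three strands
that take part; the strands to the right enter only through an arbitrary vector, those to the left
through `Qmap_left`. Left cups and caps are ordinary duality. Right caps carry weights `mu` and
right cups their inverses, so rotating a crossing is a transpose of its matrix in one or both
strands, conjugated by `mu` when right cups and caps are used.

Every crossing except the classical one of two α-strands exchanges basis vectors up to a scalar
(`swapCoeffs`). The classical ones send v_i ⊗ v_j to a combination of v_j ⊗ v_i and v_i ⊗ v_j
(`heckeCoeffs`). Both kinds preserve the pair of indices, so a product of scalars attached to the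
two strands does not change. This settles the rotation move (`rotLMap_eq_rotRMap`) and every move
that slides a strand acting only by scalars across a crossing (`slide_left`, `slide_right`): the
virtual and mixed third moves, the third move with an Ω-strand on top, and the semi-welded move. The
third move of three α-strands is the Yang–Baxter equation; it reduces to a_i² = 1 + h a_i, with h =
q⁻¹ - q and a_i the diagonal coefficients, and to the combinatorics of ordering three indices
(`yang_baxter_coeffs`).

Antiparallel second moves and classical curls lead to sums of h μ_j, or h μ_j⁻¹, over intervals of
indices. There is a sequence T with a_j μ_j = T_j and a_j⁻¹ μ_j = T_{j+1} (`Telescopes`,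
`telescopes_gl`), so h μ_j = T_j - T_{j+1} and all these sums telescope. Curls become the scalars
T_0 = q^{n-m} and T_{m+n} = q^{m-n} or their inverses, which is why opposite curls cancel.

Passing under Ω-strands differs from passing virtually by a scalar on the odd part, a product of
variables and inverse variables (`underAll_basis`); along the commutator word this product is 1.

For m = n = 1 a classical curl is the identity and a virtual α-curl is q or q⁻¹. Equality up to a
power of q is a congruence on diagrams (`valueRel`), so it contains everything the moves generate.
-/

namespace Prismatic

open Palette Color Letter

noncomputable section

variable {g : ℕ}

section

/-! ### Evaluation on pure tensors -/

section Evaluation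

variable {A B C D M N : ModuleCat.{0} (K g)}

/-- A pure tensor in a tensor product of objects. -/
def tm (x : A) (y : B) : (A ⊗ B : ModuleCat.{0} (K g)) := x ⊗ₜ[K g] y

/-- The linear map underlying a morphism. -/
def ap (f : A ⟶ B) : A →ₗ[K g] B := f.hom

/-- The pairing `(x ⊗ y, w) ↦ x ⊗ (y ⊗ w)`. -/
def asc : (A ⊗ B : ModuleCat.{0} (K g)) →ₗ[K g] M →ₗ[K g] (A ⊗ (B ⊗ M) : ModuleCat.{0} (K g)) :=
  TensorProduct.curry (TensorProduct.assoc (K g) A B M).toLinearMap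

theorem tm_add (x : A) (y y' : B) : tm x (y + y') = tm x y + tm x y' := TensorProduct.tmul_add ..
theorem tm_smul (c : K g) (x : A) (y : B) : tm x (c • y) = c • tm x y := TensorProduct.tmul_smul ..
theorem tm_zero (x : A) : tm x (0 : B) = 0 := TensorProduct.tmul_zero ..
theorem tm_sum {ι : Type*} (s : Finset ι) (x : A) (y : ι → B) :
    tm x (∑ i ∈ s, y i) = ∑ i ∈ s, tm x (y i) := TensorProduct.tmul_sum ..

theorem asc_tm (x : A) (y : B) (w : M) : asc (tm x y) w = tm x (tm y w) := rfl

theorem ap_comp (f : A ⟶ B) (h : B ⟶ C) (x : A) : ap (f ≫ h) x = ap h (ap f x) := rfl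
theorem ap_id (x : A) : ap (𝟙 A) x = x := rfl
theorem ap_smul (c : K g) (f : A ⟶ B) (x : A) : ap (c • f) x = c • ap f x := rfl
theorem ap_whiskerLeft (f : B ⟶ C) (x : A) (y : B) : ap (A ◁ f) (tm x y) = tm x (ap f y) := rfl
theorem ap_onTwo (f : A ⊗ B ⟶ C ⊗ D) (x : A) (y : B) (w : M) :
    ap (onTwo f M) (tm x (tm y w)) = asc (ap f (tm x y)) w := rfl
/-- The vector that a cup creates. -/
def vect (f : ModuleCat.of (K g) (K g) ⟶ A ⊗ B) : (A ⊗ B : ModuleCat.{0} (K g)) := ap f (1 : K g)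

theorem ap_onCup (f : ModuleCat.of (K g) (K g) ⟶ A ⊗ B) (w : M) :
    ap (onCup f M) w = asc (vect f) w := rfl
/-- The scalar that a cap assigns to a vector. -/
def scal (f : A ⊗ B ⟶ ModuleCat.of (K g) (K g)) (t : (A ⊗ B : ModuleCat.{0} (K g))) : K g := ap f t

theorem ap_onCap (f : A ⊗ B ⟶ ModuleCat.of (K g) (K g)) (x : A) (y : B) (w : M) :
    ap (onCap f M) (tm x (tm y w)) = scal f (tm x y) • w := rfl

theorem ap_ext {f h : A ⟶ B} (H : ∀ x, ap f x = ap h x) : f = h :=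
  ModuleCat.hom_ext (LinearMap.ext H)

/-- Only the strands that a move involves need a basis. The last factor is tested on all vectors, so
no basis of the space of a whole word is ever chosen. -/
theorem ap_ext_tm {ι : Type*} (b : Module.Basis ι (K g) A) {f h : A ⊗ B ⟶ C}
    (H : ∀ i y, ap f (tm (b i) y) = ap h (tm (b i) y)) : f = h := by
  refine ModuleCat.hom_ext (TensorProduct.ext ?_)
  refine b.ext fun i => LinearMap.ext fun y => H i y

theorem ap_ext_tm₂ {ι κ : Type*} (b : Module.Basis ι (K g) A) (b' : Module.Basis κ (K g) B)
    {f h : A ⊗ (B ⊗ C) ⟶ D}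
    (H : ∀ i j w, ap f (tm (b i) (tm (b' j) w)) = ap h (tm (b i) (tm (b' j) w))) : f = h := by
  refine ModuleCat.hom_ext (TensorProduct.ext ?_)
  refine b.ext fun i => TensorProduct.ext (b'.ext fun j => LinearMap.ext fun w => H i j w)

theorem ap_ext_tm₃ {ι κ l : Type*} (b : Module.Basis ι (K g) A) (b' : Module.Basis κ (K g) B)
    (b'' : Module.Basis l (K g) C) {f h : A ⊗ (B ⊗ (C ⊗ D)) ⟶ M}
    (H : ∀ i j k w, ap f (tm (b i) (tm (b' j) (tm (b'' k) w))) =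
      ap h (tm (b i) (tm (b' j) (tm (b'' k) w)))) : f = h := by
  refine ModuleCat.hom_ext (TensorProduct.ext ?_)
  refine b.ext fun i => TensorProduct.ext (b'.ext fun j => TensorProduct.ext
    (b''.ext fun k => LinearMap.ext fun w => H i j k w))

/-- Naturality of `asc` in its last argument. -/
theorem ap_asc_naturality (h : M ⟶ N) (t : (A ⊗ B : ModuleCat.{0} (K g))) (w : M) :
    ap (A ◁ B ◁ h) (asc t w) = asc t (ap h w) := by
  have : (ap (A ◁ B ◁ h)) ∘ₗ asc.flip w = asc.flip (ap h w) := TensorProduct.ext rfl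
  exact LinearMap.congr_fun this t

/-- The two maps act on disjoint tensor factors. This and the next two statements give the exchange
of far-apart slices. -/
theorem onTwo_naturality (f : A ⊗ B ⟶ C ⊗ D) (h : M ⟶ N) :
    onTwo f M ≫ C ◁ D ◁ h = A ◁ B ◁ h ≫ onTwo f N := by
  refine ModuleCat.hom_ext (TensorProduct.ext ?_)
  refine LinearMap.ext fun x => TensorProduct.ext (LinearMap.ext fun y => LinearMap.ext fun w => ?_)
  exact (ap_asc_naturality h (ap f (tm x y)) w)

theorem onCup_naturality (f : ModuleCat.of (K g) (K g) ⟶ A ⊗ B) (h : M ⟶ N) :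
    onCup f M ≫ A ◁ B ◁ h = h ≫ onCup f N := by
  refine ap_ext fun w => ?_
  simp [ap_comp, ap_onCup, ap_asc_naturality]

theorem onCap_naturality (f : A ⊗ B ⟶ ModuleCat.of (K g) (K g)) (h : M ⟶ N) :
    onCap f M ≫ h = A ◁ B ◁ h ≫ onCap f N := by
  refine ModuleCat.hom_ext (TensorProduct.ext ?_)
  refine LinearMap.ext fun x => TensorProduct.ext (LinearMap.ext fun y => LinearMap.ext fun w => ?_)
  exact (ap h).map_smul (scal f (tm x y)) w

end Evaluation

/-! ### Bases and matrix coefficients -/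

/-- The index set of the basis of the space of a colour. -/
def Ix (m n : ℕ) : Color g → Type
  | alpha => Fin (m + n)
  | om _ => Unit

instance (m n : ℕ) (c : Color g) : Fintype (Ix m n c) := by
  cases c <;> (unfold Ix; infer_instance)

instance (m n : ℕ) (c : Color g) : DecidableEq (Ix m n c) := by
  cases c <;> (unfold Ix; infer_instance)

variable (m n : ℕ)

/-- The basis of the space of an upward strand. -/
def bu : (c : Color g) → Module.Basis (Ix m n c) (K g) (Qletter m n (up c))
  | alpha => vb m n g
  | om _ => Module.Basis.singleton Unit (K g)

/-- The basis of the space of a downward strand. -/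
def bd : (c : Color g) → Module.Basis (Ix m n c) (K g) (Qletter m n (dn c))
  | alpha => db m n g
  | om _ => Module.Basis.singleton Unit (K g)

theorem q_ne_zero : (q : K g) ≠ 0 := by
  simp [q]

theorem var_ne_zero (z : Palette g) : (var z : K g) ≠ 0 := by
  simp [var]

/-- The coefficients of the right cap. -/
def mu : (c : Color g) → Ix m n c → K g
  | alpha, k => if k.val < m then (q : K g) ^ (-(m : ℤ) + n - 1 + 2 * ((k.val : ℤ) + 1))
        else -(q : K g) ^ (3 * (m : ℤ) + n + 1 - 2 * ((k.val : ℤ) + 1))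
  | om _, _ => 1

theorem mu_ne_zero (c : Color g) (k : Ix m n c) : mu m n c k ≠ 0 := by
  cases c with
  | alpha => simp only [mu]; split_ifs <;> simp [zpow_ne_zero, q_ne_zero]
  | om z => simp [mu]

theorem bu_om (z : Palette g) (i : Ix m n (om z)) : bu m n (om z) i = (1 : K g) :=
  Module.Basis.singleton_apply Unit (K g) i

theorem bd_om (z : Palette g) (i : Ix m n (om z)) : bd m n (om z) i = (1 : K g) :=
  Module.Basis.singleton_apply Unit (K g) i

theorem contractLeft_db_vb (i j : Fin (m + n)) :
    contractLeft (K g) (V m n g) (db m n g i ⊗ₜ[K g] vb m n g j) = if i = j then 1 else 0 := by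
  rw [contractLeft_apply, db, Module.Basis.dualBasis_apply_self]
  exact if_congr eq_comm rfl rfl

theorem capL_basis (c : Color g) (i j : Ix m n c) :
    scal (QcapL m n c) (tm (bd m n c i) (bu m n c j)) = if i = j then 1 else 0 := by
  cases c with
  | alpha => exact contractLeft_db_vb m n i j
  | om z =>
    rw [bd_om, bu_om]
    refine Eq.trans ?_ (if_pos (Subsingleton.elim (α := Unit) i j)).symm
    exact mul_one (1 : K g)

theorem capRMap_basis (i j : Fin (m + n)) :
    capRMap m n (vb m n g i ⊗ₜ[K g] db m n g j) = if i = j then mu m n alpha i else 0 := by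
  rw [capRMap, ← Module.Basis.tensorProduct_apply, Module.Basis.constr_basis]
  rfl

theorem capR_basis (c : Color g) (i j : Ix m n c) :
    scal (QcapR m n c) (tm (bu m n c i) (bd m n c j)) = if i = j then mu m n c i else 0 := by
  cases c with
  | alpha => exact capRMap_basis m n i j
  | om z =>
    rw [bd_om, bu_om]
    refine Eq.trans ?_ (if_pos (Subsingleton.elim (α := Unit) i j)).symm
    exact mul_one (1 : K g)

theorem cupL_one (c : Color g) :
    vect (QcupL m n c) = ∑ k, tm (bu m n c k) (bd m n c k) := by
  cases c with
  | alpha =>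
    have h : vect (QcupL m n (g := g) alpha) = cupLMap m n 1 := rfl
    rw [h, cupLMap, LinearMap.toSpanSingleton_apply, one_smul]
    rfl
  | om z =>
    simp only [bu_om, bd_om]
    exact (Fintype.sum_unique (ι := Unit) fun _ => (1 : K g) ⊗ₜ[K g] (1 : K g)).symm

/-- The exponents in the right cup and the right cap are opposite once the prefactor q^{m-n} is
absorbed. This form makes the zigzag identities immediate. -/
theorem cupR_one (c : Color g) :
    vect (QcupR m n c) = ∑ k, (mu m n c k)⁻¹ • tm (bd m n c k) (bu m n c k) := by
  cases c with
  | alpha =>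
    have h : vect (QcupR m n (g := g) alpha) = cupRMap m n 1 := rfl
    rw [h, cupRMap, LinearMap.toSpanSingleton_apply, one_smul, Finset.smul_sum]
    refine Finset.sum_congr rfl fun k _ => ?_
    rw [smul_smul]
    refine congrArg (· • _) ?_
    simp only [mu]
    split_ifs with hk
    · rw [← zpow_neg, ← zpow_add₀ q_ne_zero]; congr 1; ring
    · refine Eq.trans ?_ inv_neg.symm
      rw [← zpow_neg, mul_neg, ← zpow_add₀ q_ne_zero]; congr 2; ring
  | om z =>
    simp only [bu_om, bd_om, mu, inv_one, one_smul]
    exact (Fintype.sum_unique (ι := Unit) fun _ => (1 : K g) ⊗ₜ[K g] (1 : K g)).symm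

/-! ### Crossings -/

/-- The diagonal coefficient of the positive crossing. -/
def diag (i : Fin (m + n)) : K g := if i.val < m then q⁻¹ else -q

/-- The sign `(-1)^{|i||j|}`. -/
def sgn (i j : Fin (m + n)) : K g := (-1) ^ (par i * par j)

/-- The coefficient of the exchange term of the positive crossing. -/
def posA (i j : Fin (m + n)) : K g := if i = j then diag m n i else sgn m n i j

/-- The coefficient of the exchange term of the negative crossing. -/
def negA (i j : Fin (m + n)) : K g := if i = j then (diag m n i)⁻¹ else sgn m n i j

/-- The coefficient of the virtual crossing of two `α`-strands. -/
def virtA (i j : Fin (m + n)) : K g :=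
  if i.val < m then (if j.val < m then 1 else q⁻¹) else (if j.val < m then q else -1)

theorem posMap_basis (i j : Fin (m + n)) :
    posMap m n (vb m n g i ⊗ₜ[K g] vb m n g j) =
      (posA m n i j : K g) • (vb m n g j ⊗ₜ[K g] vb m n g i) +
      (if j < i then q⁻¹ - q else 0 : K g) • (vb m n g i ⊗ₜ[K g] vb m n g j) := by
  rw [posMap, ← Module.Basis.tensorProduct_apply, Module.Basis.constr_basis]
  simp only [posA, diag, sgn]
  rcases lt_trichotomy i j with h | h | h
  · simp [h, h.ne, h.not_gt]
  · subst h; simp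
  · simp [h, h.ne', h.not_gt]

theorem negMap_basis (i j : Fin (m + n)) :
    negMap m n (vb m n g i ⊗ₜ[K g] vb m n g j) =
      (negA m n i j : K g) • (vb m n g j ⊗ₜ[K g] vb m n g i) +
      (if i < j then q - q⁻¹ else 0 : K g) • (vb m n g i ⊗ₜ[K g] vb m n g j) := by
  rw [negMap, ← Module.Basis.tensorProduct_apply, Module.Basis.constr_basis]
  simp only [negA, diag, sgn]
  rcases lt_trichotomy i j with h | h | h
  · simp [h, h.ne]
  · subst h; simp only [if_true, lt_irrefl, if_false, zero_smul, add_zero]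
    split_ifs
    · rw [inv_inv]
    · exact congrArg (· • _) inv_neg.symm
  · simp [h.ne', h.not_gt]

theorem virtMap_basis (i j : Fin (m + n)) :
    virtMap m n (vb m n g i ⊗ₜ[K g] vb m n g j) =
      (virtA m n i j : K g) • (vb m n g j ⊗ₜ[K g] vb m n g i) := by
  rw [virtMap, ← Module.Basis.tensorProduct_apply, Module.Basis.constr_basis]
  rfl

/-- The coefficient of a virtual crossing. -/
def virtCoeff : (c d : Color g) → Ix m n c → Ix m n d → K g
  | alpha, alpha => virtA m n
  | om _, alpha => fun _ _ => 1
  | alpha, om _ => fun _ _ => 1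
  | om _, om _ => fun _ _ => 1

/-- The value of the grading automorphism of parameter `a` on a basis vector. -/
def oddCoeff (a : K g) (i : Fin (m + n)) : K g := if i.val < m then 1 else a

theorem oddMul_basis (a : K g) (i : Fin (m + n)) :
    oddMul m n a (vb m n g i) = oddCoeff m n a i • vb m n g i := by
  rw [oddMul, Module.Basis.constr_basis, oddCoeff]
  split_ifs <;> simp

theorem pos_basis (i j : Ix m n (g := g) alpha) :
    ap (Qpos m n (g := g) alpha) (tm (bu m n alpha i) (bu m n alpha j)) =
      (posA m n i j : K g) • tm (bu m n alpha j) (bu m n alpha i) +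
      (if (show Fin (m + n) from j) < i then q⁻¹ - q else 0 : K g) •
        tm (bu m n alpha i) (bu m n alpha j) :=
  posMap_basis m n i j

theorem neg_basis (i j : Ix m n (g := g) alpha) :
    ap (Qneg m n (g := g) alpha) (tm (bu m n alpha i) (bu m n alpha j)) =
      (negA m n i j : K g) • tm (bu m n alpha j) (bu m n alpha i) +
      (if (show Fin (m + n) from i) < j then q - q⁻¹ else 0 : K g) •
        tm (bu m n alpha i) (bu m n alpha j) :=
  negMap_basis m n i j

theorem virt_basis (c d : Color g) (i : Ix m n c) (j : Ix m n d) :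
    ap (Qvirt m n c d) (tm (bu m n c i) (bu m n d j)) =
      virtCoeff m n c d i j • tm (bu m n d j) (bu m n c i) := by
  match c, d with
  | alpha, alpha => exact virtMap_basis m n i j
  | om z, alpha =>
    rw [bu_om]
    exact (congrArg (fun v : V m n g => v ⊗ₜ[K g] (1 : K g)) (one_smul (K g) _)).trans
      (one_smul (K g) _).symm
  | alpha, om z =>
    rw [bu_om]
    exact (congrArg (fun v : V m n g => (1 : K g) ⊗ₜ[K g] v) (one_smul (K g) _)).trans
      (one_smul (K g) _).symm
  | om z, om z' =>
    rw [bu_om, bu_om]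
    exact (one_smul (K g) _).symm

theorem overPos_basis (z : Palette g) (i : Ix m n (om z)) (j : Ix m n (g := g) alpha) :
    ap (Qpos m n (om z)) (tm (bu m n (om z) i) (bu m n alpha j)) =
      oddCoeff m n (var z)⁻¹ j • tm (bu m n alpha j) (bu m n (om z) i) := by
  rw [bu_om]
  exact (congrArg (fun v : V m n g => oddMul m n (var z)⁻¹ v ⊗ₜ[K g] (1 : K g))
    (one_smul (K g) _)).trans (congrArg (fun v : V m n g => v ⊗ₜ[K g] (1 : K g))
      (oddMul_basis m n (var z)⁻¹ j))

theorem overNeg_basis (z : Palette g) (i : Ix m n (g := g) alpha) (j : Ix m n (om z)) :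
    ap (Qneg m n (om z)) (tm (bu m n alpha i) (bu m n (om z) j)) =
      oddCoeff m n (var z) i • tm (bu m n (om z) j) (bu m n alpha i) := by
  refine Eq.trans ?_ (tm_smul _ _ _)
  rw [bu_om]
  exact (congrArg (fun v : V m n g => (1 : K g) ⊗ₜ[K g] oddMul m n (var z) v)
    (one_smul (K g) _)).trans (congrArg (fun v : V m n g => (1 : K g) ⊗ₜ[K g] v)
      (oddMul_basis m n (var z) i))

end

section

variable (m n : ℕ)
/-! ### Rotated crossings and curls on bases -/

section Rotated

variable {m n} {a b : Color g}

/-- The matrix coefficients of a crossing. -/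
def HasCoeffs (φ : Qletter m n (up a) ⊗ Qletter m n (up b) ⟶ Qletter m n (up b) ⊗ Qletter m n (up a))
    (F : Ix m n a → Ix m n b → Ix m n b → Ix m n a → K g) : Prop :=
  ∀ i j, ap φ (tm (bu m n a i) (bu m n b j)) = ∑ k, ∑ l, F i j k l • tm (bu m n b k) (bu m n a l)

/-- The value of `sideL`. -/
def sideLMap (φ : Qletter m n (up a) ⊗ Qletter m n (up b) ⟶ Qletter m n (up b) ⊗ Qletter m n (up a))
    (M : ModuleCat.{0} (K g)) :
    Qletter m n (dn b) ⊗ (Qletter m n (up a) ⊗ M) ⟶ Qletter m n (up a) ⊗ (Qletter m n (dn b) ⊗ M) :=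
  Qletter m n (dn b) ◁ Qletter m n (up a) ◁ onCup (QcupL m n b) M ≫
    Qletter m n (dn b) ◁ onTwo φ (Qletter m n (dn b) ⊗ M) ≫ onCap (QcapL m n b) _ ≫ 𝟙 _

/-- The value of `sideR`. -/
def sideRMap (φ : Qletter m n (up a) ⊗ Qletter m n (up b) ⟶ Qletter m n (up b) ⊗ Qletter m n (up a))
    (M : ModuleCat.{0} (K g)) :
    Qletter m n (up b) ⊗ (Qletter m n (dn a) ⊗ M) ⟶ Qletter m n (dn a) ⊗ (Qletter m n (up b) ⊗ M) :=
  onCup (QcupR m n a) (Qletter m n (up b) ⊗ (Qletter m n (dn a) ⊗ M)) ≫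
    Qletter m n (dn a) ◁ onTwo φ (Qletter m n (dn a) ⊗ M) ≫
    Qletter m n (dn a) ◁ Qletter m n (up b) ◁ onCap (QcapR m n a) M ≫ 𝟙 _

/-- The value of `rotL`. -/
def rotLMap (φ : Qletter m n (up a) ⊗ Qletter m n (up b) ⟶ Qletter m n (up b) ⊗ Qletter m n (up a))
    (M : ModuleCat.{0} (K g)) :
    Qletter m n (dn a) ⊗ (Qletter m n (dn b) ⊗ M) ⟶ Qletter m n (dn b) ⊗ (Qletter m n (dn a) ⊗ M) :=
  Qletter m n (dn a) ◁ Qletter m n (dn b) ◁ onCup (QcupL m n a) M ≫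
    Qletter m n (dn a) ◁ Qletter m n (dn b) ◁ Qletter m n (up a) ◁
      onCup (QcupL m n b) (Qletter m n (dn a) ⊗ M) ≫
    Qletter m n (dn a) ◁ Qletter m n (dn b) ◁
      onTwo φ (Qletter m n (dn b) ⊗ (Qletter m n (dn a) ⊗ M)) ≫
    Qletter m n (dn a) ◁ onCap (QcapL m n b) _ ≫ onCap (QcapL m n a) _ ≫ 𝟙 _

/-- The value of `rotR`. -/
def rotRMap (φ : Qletter m n (up a) ⊗ Qletter m n (up b) ⟶ Qletter m n (up b) ⊗ Qletter m n (up a))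
    (M : ModuleCat.{0} (K g)) :
    Qletter m n (dn a) ⊗ (Qletter m n (dn b) ⊗ M) ⟶ Qletter m n (dn b) ⊗ (Qletter m n (dn a) ⊗ M) :=
  onCup (QcupR m n b) (Qletter m n (dn a) ⊗ (Qletter m n (dn b) ⊗ M)) ≫
    Qletter m n (dn b) ◁ onCup (QcupR m n a) _ ≫
    Qletter m n (dn b) ◁ Qletter m n (dn a) ◁
      onTwo φ (Qletter m n (dn a) ⊗ (Qletter m n (dn b) ⊗ M)) ≫
    Qletter m n (dn b) ◁ Qletter m n (dn a) ◁ Qletter m n (up b) ◁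
      onCap (QcapR m n a) (Qletter m n (dn b) ⊗ M) ≫
    Qletter m n (dn b) ◁ Qletter m n (dn a) ◁ onCap (QcapR m n b) M ≫ 𝟙 _

/-- The value of `curlR`. -/
def curlRMap (φ : Qletter m n (up a) ⊗ Qletter m n (up a) ⟶ Qletter m n (up a) ⊗ Qletter m n (up a))
    (M : ModuleCat.{0} (K g)) : Qletter m n (up a) ⊗ M ⟶ Qletter m n (up a) ⊗ M :=
  Qletter m n (up a) ◁ onCup (QcupL m n a) M ≫ onTwo φ (Qletter m n (dn a) ⊗ M) ≫
    Qletter m n (up a) ◁ onCap (QcapR m n a) M ≫ 𝟙 _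

/-- The value of `curlL`. -/
def curlLMap (φ : Qletter m n (up a) ⊗ Qletter m n (up a) ⟶ Qletter m n (up a) ⊗ Qletter m n (up a))
    (M : ModuleCat.{0} (K g)) : Qletter m n (up a) ⊗ M ⟶ Qletter m n (up a) ⊗ M :=
  onCup (QcupR m n a) (Qletter m n (up a) ⊗ M) ≫ Qletter m n (dn a) ◁ onTwo φ M ≫
    onCap (QcapL m n a) _ ≫ 𝟙 _

variable {φ : Qletter m n (up a) ⊗ Qletter m n (up b) ⟶ Qletter m n (up b) ⊗ Qletter m n (up a)}
  {F : Ix m n a → Ix m n b → Ix m n b → Ix m n a → K g} (M : ModuleCat.{0} (K g))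

theorem sideLMap_basis (h : HasCoeffs φ F) (i : Ix m n b) (j : Ix m n a) (w : M) :
    ap (sideLMap φ M) (tm (bd m n b i) (tm (bu m n a j) w)) =
      ∑ k, ∑ l, F j k i l • tm (bu m n a l) (tm (bd m n b k) w) := by
  simp only [sideLMap, ap_comp, ap_id, ap_whiskerLeft, ap_onTwo, ap_onCup, ap_onCap, cupL_one, h j,
    map_sum, map_smul, LinearMap.sum_apply, LinearMap.smul_apply, asc_tm, tm_sum, tm_smul,
    capL_basis, ite_smul, one_smul, zero_smul, smul_ite, smul_zero]
  refine Finset.sum_congr rfl fun k _ => ?_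
  rw [Finset.sum_comm]
  simp

theorem sideRMap_basis (h : HasCoeffs φ F) (i : Ix m n b) (j : Ix m n a) (w : M) :
    ap (sideRMap φ M) (tm (bu m n b i) (tm (bd m n a j) w)) =
      ∑ k, ∑ l, ((mu m n a k)⁻¹ * F k i l j * mu m n a j) •
        tm (bd m n a k) (tm (bu m n b l) w) := by
  simp only [sideRMap, ap_comp, ap_id, ap_whiskerLeft, ap_onTwo, ap_onCup, ap_onCap, cupR_one, h _ i,
    map_sum, map_smul, LinearMap.sum_apply, LinearMap.smul_apply, asc_tm, tm_sum, tm_smul,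
    capR_basis, ite_smul, zero_smul, smul_ite, smul_zero, tm_zero, apply_ite (tm _)]
  refine Finset.sum_congr rfl fun k _ => ?_
  simp [Finset.smul_sum, smul_smul, mul_assoc]

theorem rotLMap_basis (h : HasCoeffs φ F) (i : Ix m n a) (j : Ix m n b) (w : M) :
    ap (rotLMap φ M) (tm (bd m n a i) (tm (bd m n b j) w)) =
      ∑ k, ∑ l, F k l j i • tm (bd m n b l) (tm (bd m n a k) w) := by
  simp only [rotLMap, ap_comp, ap_id, ap_whiskerLeft, ap_onTwo, ap_onCup, ap_onCap, cupL_one, h _ _,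
    map_sum, map_smul, LinearMap.sum_apply, LinearMap.smul_apply, asc_tm, tm_sum, tm_smul,
    capL_basis, ite_smul, one_smul, zero_smul, smul_ite, smul_zero, tm_zero, apply_ite (tm _),
    apply_ite (ap _), map_zero]
  refine Finset.sum_congr rfl fun k _ => Finset.sum_congr rfl fun l _ => ?_
  rw [Finset.sum_comm]
  simp

theorem rotRMap_basis (h : HasCoeffs φ F) (i : Ix m n a) (j : Ix m n b) (w : M) :
    ap (rotRMap φ M) (tm (bd m n a i) (tm (bd m n b j) w)) =
      ∑ k, ∑ l, ((mu m n a k * mu m n b l)⁻¹ * F k l j i * (mu m n a i * mu m n b j)) •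
        tm (bd m n b l) (tm (bd m n a k) w) := by
  simp only [rotRMap, ap_comp, ap_id, ap_whiskerLeft, ap_onTwo, ap_onCup, ap_onCap, cupR_one, h _ _,
    map_sum, map_smul, LinearMap.sum_apply, LinearMap.smul_apply, asc_tm, tm_sum, tm_smul,
    capR_basis, ite_smul, zero_smul, smul_ite, smul_zero, tm_zero, apply_ite (tm _),
    apply_ite (ap _), map_zero]
  -- The cup of colour `b` is opened first here, so the sum over `l` comes out as the outer one.
  refine Eq.trans (Finset.sum_congr rfl fun l _ => ?_) Finset.sum_comm
  rw [Finset.smul_sum]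
  refine Finset.sum_congr rfl fun k _ => ?_
  rw [Finset.sum_comm]
  simp only [Finset.sum_ite_eq', Finset.sum_ite_irrel, Finset.sum_const_zero, Finset.mem_univ,
    if_true, smul_smul]
  congr 1
  rw [mul_inv]
  ring

variable {ψ : Qletter m n (up a) ⊗ Qletter m n (up a) ⟶ Qletter m n (up a) ⊗ Qletter m n (up a)}
  {G : Ix m n a → Ix m n a → Ix m n a → Ix m n a → K g}

theorem curlRMap_basis (h : HasCoeffs ψ G) (i : Ix m n a) (w : M) :
    ap (curlRMap ψ M) (tm (bu m n a i) w) =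
      ∑ k, ∑ l, (G i k l k * mu m n a k) • tm (bu m n a l) w := by
  simp only [curlRMap, ap_comp, ap_id, ap_whiskerLeft, ap_onTwo, ap_onCup, ap_onCap, cupL_one, h i _,
    map_sum, map_smul, LinearMap.sum_apply, LinearMap.smul_apply, asc_tm, tm_sum, tm_smul,
    capR_basis, ite_smul, zero_smul, smul_ite, smul_zero, tm_zero, apply_ite (tm _),
    apply_ite (ap _), map_zero]
  simp [smul_smul]

theorem curlLMap_basis (h : HasCoeffs ψ G) (i : Ix m n a) (w : M) :
    ap (curlLMap ψ M) (tm (bu m n a i) w) =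
      ∑ k, ∑ l, ((mu m n a k)⁻¹ * G k i k l) • tm (bu m n a l) w := by
  simp only [curlLMap, ap_comp, ap_id, ap_whiskerLeft, ap_onTwo, ap_onCup, ap_onCap, cupR_one, h _ i,
    map_sum, map_smul, LinearMap.sum_apply, LinearMap.smul_apply, asc_tm, tm_sum, tm_smul,
    capL_basis, ite_smul, one_smul, zero_smul, smul_ite, smul_zero,
    apply_ite (ap _), map_zero]
  refine Finset.sum_congr rfl fun k _ => ?_
  rw [Finset.sum_comm]
  simp [smul_smul, Finset.smul_sum]

end Rotated

end

section

variable {m n : ℕ} {a b c : Color g}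
/-! ### Crossings that exchange basis vectors up to scalars -/

/-- The matrix coefficients of a crossing that exchanges basis vectors up to scalars. -/
def swapCoeffs (A : Ix m n a → Ix m n b → K g) :
    Ix m n a → Ix m n b → Ix m n b → Ix m n a → K g :=
  fun i j k l => if k = j ∧ l = i then A i j else 0

section Swap

variable {φ : Qletter m n (up a) ⊗ Qletter m n (up b) ⟶ Qletter m n (up b) ⊗ Qletter m n (up a)}
  {ψ : Qletter m n (up b) ⊗ Qletter m n (up a) ⟶ Qletter m n (up a) ⊗ Qletter m n (up b)}
  {A : Ix m n a → Ix m n b → K g} {A' : Ix m n b → Ix m n a → K g} (M : ModuleCat.{0} (K g))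

theorem hasCoeffs_swap
    (h : ∀ i j, ap φ (tm (bu m n a i) (bu m n b j)) = A i j • tm (bu m n b j) (bu m n a i)) :
    HasCoeffs φ (swapCoeffs A) := by
  intro i j
  simp [h, swapCoeffs, ite_and]

theorem HasCoeffs.onTwo_swap (h : HasCoeffs φ (swapCoeffs A)) (i : Ix m n a) (j : Ix m n b) (w : M) :
    ap (onTwo φ M) (tm (bu m n a i) (tm (bu m n b j) w)) =
      A i j • tm (bu m n b j) (tm (bu m n a i) w) := by
  simp [ap_onTwo, h i j, swapCoeffs, ite_and, asc_tm]

theorem HasCoeffs.sideL_swap (h : HasCoeffs φ (swapCoeffs A)) (i : Ix m n b) (j : Ix m n a) (w : M) :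
    ap (sideLMap φ M) (tm (bd m n b i) (tm (bu m n a j) w)) =
      A j i • tm (bu m n a j) (tm (bd m n b i) w) := by
  simp [sideLMap_basis M h, swapCoeffs, ite_and]

/-- The strand of colour `a` keeps its index, so the weight of the right cup cancels that of the
right cap. -/
theorem HasCoeffs.sideR_swap (h : HasCoeffs φ (swapCoeffs A)) (i : Ix m n b) (j : Ix m n a) (w : M) :
    ap (sideRMap φ M) (tm (bu m n b i) (tm (bd m n a j) w)) =
      A j i • tm (bd m n a j) (tm (bu m n b i) w) := by
  simp only [sideRMap_basis M h, swapCoeffs, ite_and]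
  rw [Finset.sum_eq_single j]
  · rw [Finset.sum_eq_single i]
    · simp [mul_right_comm _ (A j i), mu_ne_zero]
    · simp +contextual
    · simp
  · intro k _ hk
    simp [Ne.symm hk]
  · simp

theorem HasCoeffs.rotL_swap (h : HasCoeffs φ (swapCoeffs A)) (i : Ix m n a) (j : Ix m n b) (w : M) :
    ap (rotLMap φ M) (tm (bd m n a i) (tm (bd m n b j) w)) =
      A i j • tm (bd m n b j) (tm (bd m n a i) w) := by
  simp [rotLMap_basis M h, swapCoeffs, ite_and]

theorem HasCoeffs.curlR_swap {χ : Qletter m n (up c) ⊗ Qletter m n (up c) ⟶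
      Qletter m n (up c) ⊗ Qletter m n (up c)} {C : Ix m n c → Ix m n c → K g}
    (h : HasCoeffs χ (swapCoeffs C)) (i : Ix m n c) (w : M) :
    ap (curlRMap χ M) (tm (bu m n c i) w) = (C i i * mu m n c i) • tm (bu m n c i) w := by
  simp [curlRMap_basis M h, swapCoeffs, ite_and]

theorem HasCoeffs.curlL_swap {χ : Qletter m n (up c) ⊗ Qletter m n (up c) ⟶
      Qletter m n (up c) ⊗ Qletter m n (up c)} {C : Ix m n c → Ix m n c → K g}
    (h : HasCoeffs χ (swapCoeffs C)) (i : Ix m n c) (w : M) :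
    ap (curlLMap χ M) (tm (bu m n c i) w) = ((mu m n c i)⁻¹ * C i i) • tm (bu m n c i) w := by
  simp [curlLMap_basis M h, swapCoeffs, ite_and]

theorem swap_r2 (h : HasCoeffs φ (swapCoeffs A)) (h' : HasCoeffs ψ (swapCoeffs A'))
    (H : ∀ i j, A i j * A' j i = 1) : onTwo φ M ≫ onTwo ψ M ≫ 𝟙 _ = 𝟙 _ :=
  ap_ext_tm₂ (bu m n a) (bu m n b) fun i j w => by
    simp [ap_comp, ap_id, h.onTwo_swap, h'.onTwo_swap, smul_smul, H]

theorem swap_r2anti₁ (h : HasCoeffs φ (swapCoeffs A)) (h' : HasCoeffs ψ (swapCoeffs A'))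
    (H : ∀ i j, A i j * A' j i = 1) : sideLMap φ M ≫ sideRMap ψ M = 𝟙 _ :=
  ap_ext_tm₂ (bd m n b) (bu m n a) fun i j w => by
    simp [ap_comp, ap_id, h.sideL_swap, h'.sideR_swap, smul_smul, H]

theorem swap_r2anti₂ (h : HasCoeffs φ (swapCoeffs A)) (h' : HasCoeffs ψ (swapCoeffs A'))
    (H : ∀ i j, A i j * A' j i = 1) : sideRMap ψ M ≫ sideLMap φ M = 𝟙 _ :=
  ap_ext_tm₂ (bu m n a) (bd m n b) fun i j w => by
    simp [ap_comp, ap_id, h.sideL_swap, h'.sideR_swap, smul_smul, mul_comm (A' _ _), H]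

end Swap

/-- A crossing that preserves the weight can be rotated by a half turn in either direction. -/
theorem rotLMap_eq_rotRMap
    {φ : Qletter m n (up a) ⊗ Qletter m n (up b) ⟶ Qletter m n (up b) ⊗ Qletter m n (up a)}
    {F : Ix m n a → Ix m n b → Ix m n b → Ix m n a → K g} (M : ModuleCat.{0} (K g))
    (h : HasCoeffs φ F)
    (H : ∀ i j k l, F k l j i ≠ 0 → mu m n a k * mu m n b l = mu m n a i * mu m n b j) :
    rotLMap φ M = rotRMap φ M := by
  refine ap_ext_tm₂ (bd m n a) (bd m n b) fun i j w => ?_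
  rw [rotLMap_basis M h, rotRMap_basis M h]
  refine Finset.sum_congr rfl fun k _ => Finset.sum_congr rfl fun l _ => ?_
  congr 1
  by_cases h0 : F k l j i = 0
  · simp [h0]
  · rw [H i j k l h0, mul_right_comm, inv_mul_cancel₀ (mul_ne_zero (mu_ne_zero m n a i) (mu_ne_zero m n b j)),
      one_mul]

theorem swap_rotate
    {φ : Qletter m n (up a) ⊗ Qletter m n (up b) ⟶ Qletter m n (up b) ⊗ Qletter m n (up a)}
    {A : Ix m n a → Ix m n b → K g} (M : ModuleCat.{0} (K g)) (h : HasCoeffs φ (swapCoeffs A)) :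
    rotLMap φ M = rotRMap φ M := by
  refine rotLMap_eq_rotRMap M h fun i j k l hF => ?_
  simp only [swapCoeffs, ne_eq, ite_eq_right_iff, Classical.not_imp] at hF
  rw [hF.1.1, hF.1.2]

/-- A strand of colour `c` on the right is moved across a crossing. -/
theorem slide_right
    {φ : Qletter m n (up a) ⊗ Qletter m n (up b) ⟶ Qletter m n (up b) ⊗ Qletter m n (up a)}
    {χ : Qletter m n (up a) ⊗ Qletter m n (up c) ⟶ Qletter m n (up c) ⊗ Qletter m n (up a)}
    {χ' : Qletter m n (up b) ⊗ Qletter m n (up c) ⟶ Qletter m n (up c) ⊗ Qletter m n (up b)}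
    {F : Ix m n a → Ix m n b → Ix m n b → Ix m n a → K g} {C : Ix m n a → Ix m n c → K g}
    {C' : Ix m n b → Ix m n c → K g} (M : ModuleCat.{0} (K g))
    (hφ : HasCoeffs φ F) (h : HasCoeffs χ (swapCoeffs C)) (h' : HasCoeffs χ' (swapCoeffs C'))
    (H : ∀ i j k l x, F i j k l ≠ 0 → C l x * C' k x = C i x * C' j x) :
    onTwo φ (Qletter m n (up c) ⊗ M) ≫ Qletter m n (up b) ◁ onTwo χ M ≫
        onTwo χ' (Qletter m n (up a) ⊗ M) ≫ 𝟙 _ =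
      Qletter m n (up a) ◁ onTwo χ' M ≫ onTwo χ (Qletter m n (up b) ⊗ M) ≫
        Qletter m n (up c) ◁ onTwo φ M ≫ 𝟙 _ := by
  refine ap_ext_tm₃ (bu m n a) (bu m n b) (bu m n c) fun i j x w => ?_
  simp only [ap_comp, ap_id, ap_whiskerLeft, h.onTwo_swap, h'.onTwo_swap, ap_onTwo φ, hφ i j,
    map_sum, map_smul, LinearMap.sum_apply, LinearMap.smul_apply, asc_tm, tm_sum, tm_smul,
    Finset.smul_sum, smul_smul]
  refine Finset.sum_congr rfl fun k _ => Finset.sum_congr rfl fun l _ => ?_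
  congr 1
  by_cases h0 : F i j k l = 0
  · simp [h0]
  · linear_combination F i j k l * H i j k l x h0

/-- A strand of colour `c` on the left is moved across a crossing. -/
theorem slide_left
    {φ : Qletter m n (up a) ⊗ Qletter m n (up b) ⟶ Qletter m n (up b) ⊗ Qletter m n (up a)}
    {χ : Qletter m n (up c) ⊗ Qletter m n (up a) ⟶ Qletter m n (up a) ⊗ Qletter m n (up c)}
    {χ' : Qletter m n (up c) ⊗ Qletter m n (up b) ⟶ Qletter m n (up b) ⊗ Qletter m n (up c)}
    {F : Ix m n a → Ix m n b → Ix m n b → Ix m n a → K g} {C : Ix m n c → Ix m n a → K g}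
    {C' : Ix m n c → Ix m n b → K g} (M : ModuleCat.{0} (K g))
    (hφ : HasCoeffs φ F) (h : HasCoeffs χ (swapCoeffs C)) (h' : HasCoeffs χ' (swapCoeffs C'))
    (H : ∀ i j k l x, F i j k l ≠ 0 → C x l * C' x k = C x i * C' x j) :
    onTwo χ (Qletter m n (up b) ⊗ M) ≫ Qletter m n (up a) ◁ onTwo χ' M ≫
        onTwo φ (Qletter m n (up c) ⊗ M) ≫ 𝟙 _ =
      Qletter m n (up c) ◁ onTwo φ M ≫ onTwo χ' (Qletter m n (up a) ⊗ M) ≫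
        Qletter m n (up b) ◁ onTwo χ M ≫ 𝟙 _ := by
  refine ap_ext_tm₃ (bu m n c) (bu m n a) (bu m n b) fun x i j w => ?_
  simp only [ap_comp, ap_id, ap_whiskerLeft, h.onTwo_swap, h'.onTwo_swap, ap_onTwo φ, hφ i j,
    map_sum, map_smul, LinearMap.sum_apply, LinearMap.smul_apply, asc_tm, tm_sum, tm_smul,
    Finset.smul_sum, smul_smul]
  refine Finset.sum_congr rfl fun k _ => Finset.sum_congr rfl fun l _ => ?_
  congr 1
  by_cases h0 : F i j k l = 0
  · simp [h0]
  · linear_combination -F i j k l * H i j k l x h0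

/-! ### Crossings of Hecke type -/

/-- The matrix coefficients of a crossing of two strands of the same colour that maps
`v_i ⊗ v_j` to a combination of `v_j ⊗ v_i` and `v_i ⊗ v_j`. -/
def heckeCoeffs (A B : Ix m n a → Ix m n a → K g) :
    Ix m n a → Ix m n a → Ix m n a → Ix m n a → K g :=
  fun i j k l => (if k = j ∧ l = i then A i j else 0) + (if k = i ∧ l = j then B i j else 0)

section Hecke

variable {φ ψ : Qletter m n (up a) ⊗ Qletter m n (up a) ⟶ Qletter m n (up a) ⊗ Qletter m n (up a)}
  {A B A' B' : Ix m n a → Ix m n a → K g} (M : ModuleCat.{0} (K g))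

theorem hasCoeffs_hecke
    (h : ∀ i j, ap φ (tm (bu m n a i) (bu m n a j)) =
      A i j • tm (bu m n a j) (bu m n a i) + B i j • tm (bu m n a i) (bu m n a j)) :
    HasCoeffs φ (heckeCoeffs A B) := by
  intro i j
  simp [h, heckeCoeffs, ite_and, add_smul, Finset.sum_add_distrib]

theorem HasCoeffs.onTwo_hecke (h : HasCoeffs φ (heckeCoeffs A B)) (i j : Ix m n a) (w : M) :
    ap (onTwo φ M) (tm (bu m n a i) (tm (bu m n a j) w)) =
      A i j • tm (bu m n a j) (tm (bu m n a i) w) + B i j • tm (bu m n a i) (tm (bu m n a j) w) := by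
  simp [ap_onTwo, h i j, heckeCoeffs, ite_and, asc_tm, add_smul, Finset.sum_add_distrib]

/-- Transposing one strand turns the term that fixes v_i ⊗ v_j into a cap followed by a cup: it sees
only equal indices and creates every pair of equal indices. -/
theorem HasCoeffs.sideL_hecke (h : HasCoeffs φ (heckeCoeffs A B)) (i j : Ix m n a) (w : M) :
    ap (sideLMap φ M) (tm (bd m n a i) (tm (bu m n a j) w)) =
      A j i • tm (bu m n a j) (tm (bd m n a i) w) +
        if i = j then ∑ k, B j k • tm (bu m n a k) (tm (bd m n a k) w) else 0 := by
  simp [sideLMap_basis M h, heckeCoeffs, ite_and, add_smul, Finset.sum_add_distrib,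
    Finset.sum_ite_irrel]

theorem HasCoeffs.sideR_hecke (h : HasCoeffs φ (heckeCoeffs A B)) (i j : Ix m n a) (w : M) :
    ap (sideRMap φ M) (tm (bu m n a i) (tm (bd m n a j) w)) =
      A j i • tm (bd m n a j) (tm (bu m n a i) w) +
        if i = j then ∑ k, ((mu m n a k)⁻¹ * B k i * mu m n a j) •
          tm (bd m n a k) (tm (bu m n a k) w) else 0 := by
  have e : (mu m n a j)⁻¹ * A j i * mu m n a j = A j i := by
    rw [mul_right_comm, inv_mul_cancel₀ (mu_ne_zero m n a j), one_mul]
  simp [sideRMap_basis M h, heckeCoeffs, ite_and, add_smul, Finset.sum_add_distrib,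
    Finset.sum_ite_irrel, mul_add, add_mul, mul_ite, ite_mul, e, eq_comm (a := j)]

theorem HasCoeffs.curlR_hecke (h : HasCoeffs φ (heckeCoeffs A B)) (i : Ix m n a) (w : M) :
    ap (curlRMap φ M) (tm (bu m n a i) w) =
      (A i i * mu m n a i + ∑ k, B i k * mu m n a k) • tm (bu m n a i) w := by
  simp [curlRMap_basis M h, heckeCoeffs, ite_and, add_smul, add_mul, ite_mul,
    Finset.sum_add_distrib, Finset.sum_smul]

theorem HasCoeffs.curlL_hecke (h : HasCoeffs φ (heckeCoeffs A B)) (i : Ix m n a) (w : M) :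
    ap (curlLMap φ M) (tm (bu m n a i) w) =
      ((mu m n a i)⁻¹ * A i i + ∑ k, (mu m n a k)⁻¹ * B k i) • tm (bu m n a i) w := by
  simp [curlLMap_basis M h, heckeCoeffs, ite_and, add_smul, mul_add, mul_ite,
    Finset.sum_add_distrib, Finset.sum_smul]

theorem smul_exchange {R X : Type*} [CommRing R] [AddCommGroup X] [Module R X] {p r s t : R}
    (h : p + t = 1) (h' : r + s = 0) (x y : X) : p • x + r • y + (s • y + t • x) = x := by
  linear_combination (norm := module) h • x + h' • y

theorem hecke_r2 (h : HasCoeffs φ (heckeCoeffs A B)) (h' : HasCoeffs ψ (heckeCoeffs A' B'))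
    (H : ∀ i j, A i j * A' j i + B i j * B' i j = 1)
    (H' : ∀ i j, A i j * B' j i + B i j * A' i j = 0) : onTwo φ M ≫ onTwo ψ M ≫ 𝟙 _ = 𝟙 _ :=
  ap_ext_tm₂ (bu m n a) (bu m n a) fun i j w => by
    simp only [ap_comp, ap_id, h.onTwo_hecke, h'.onTwo_hecke, map_add, map_smul, smul_add,
      smul_smul]
    exact smul_exchange (H i j) (H' i j) _ _

theorem hecke_rotate (h : HasCoeffs φ (heckeCoeffs A B)) : rotLMap φ M = rotRMap φ M := by
  refine rotLMap_eq_rotRMap M h fun i j k l hF => ?_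
  by_cases h₁ : j = l ∧ i = k
  · rw [h₁.1, h₁.2]
  by_cases h₂ : j = k ∧ i = l
  · rw [h₂.1, h₂.2, mul_comm]
  · simp [heckeCoeffs, h₁, h₂] at hF

/-- In `H'` the summands are the ways to pass from the pair (i, i) to the pair (l, l) using a
cap-cup term: in the second crossing, in the first, or in both, through an intermediate index k. -/
theorem hecke_r2anti₁ (h : HasCoeffs φ (heckeCoeffs A B)) (h' : HasCoeffs ψ (heckeCoeffs A' B'))
    (H : ∀ i j, A i j * A' j i = 1)
    (H' : ∀ i l, A i i * ((mu m n a l)⁻¹ * B' l i * mu m n a i) + B i l * A' l l +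
      ∑ k, B i k * ((mu m n a l)⁻¹ * B' l k * mu m n a k) = 0) :
    sideLMap φ M ≫ sideRMap ψ M = 𝟙 _ :=
  ap_ext_tm₂ (bd m n a) (bu m n a) fun i j w => by
    rw [ap_comp, h.sideL_hecke, ap_id]
    rcases eq_or_ne i j with rfl | hij
    · simp only [map_add, map_smul, map_sum, h'.sideR_hecke, if_true, smul_add, smul_smul, H,
        one_smul, Finset.smul_sum, Finset.sum_add_distrib]
      -- The exchange terms already give the identity; the rest is collected by the final index l so
      -- that `H'` kills each coefficient.
      rw [add_assoc, add_eq_left, Finset.sum_comm, ← Finset.sum_add_distrib,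
        ← Finset.sum_add_distrib]
      refine Finset.sum_eq_zero fun l _ => ?_
      rw [← Finset.sum_smul, ← add_smul, ← add_smul, ← add_assoc, H', zero_smul]
    · simp [hij, h'.sideR_hecke, hij.symm, smul_smul, H]

theorem hecke_r2anti₂ (h : HasCoeffs φ (heckeCoeffs A B)) (h' : HasCoeffs ψ (heckeCoeffs A' B'))
    (H : ∀ i j, A' i j * A j i = 1)
    (H' : ∀ i l, A' i i * B i l + ((mu m n a l)⁻¹ * B' l i * mu m n a i) * A l l +
      ∑ k, ((mu m n a k)⁻¹ * B' k i * mu m n a i) * B k l = 0) :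
    sideRMap ψ M ≫ sideLMap φ M = 𝟙 _ :=
  ap_ext_tm₂ (bu m n a) (bd m n a) fun i j w => by
    rw [ap_comp, h'.sideR_hecke, ap_id]
    rcases eq_or_ne i j with rfl | hij
    · simp only [map_add, map_smul, map_sum, h.sideL_hecke, if_true, smul_add, smul_smul, H,
        one_smul, Finset.smul_sum, Finset.sum_add_distrib]
      rw [add_assoc, add_eq_left, Finset.sum_comm, ← Finset.sum_add_distrib,
        ← Finset.sum_add_distrib]
      refine Finset.sum_eq_zero fun l _ => ?_
      rw [← Finset.sum_smul, ← add_smul, ← add_smul, ← add_assoc, H', zero_smul]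
    · simp [hij, h.sideL_hecke, hij.symm, smul_smul, H]

end Hecke

end

section

/-! ### Scalar identities -/

section Scalars

variable {k : Type*} [Field k]

/-- Telescoping over a half-open interval, with the interval encoded by an indicator because the
matrix coefficients produce sums over all of `Fin N`. -/
theorem sum_window {N : ℕ} {f : Fin N → k} {T : ℕ → k} (h : ∀ j, f j = T (j + 1) - T j) {l i : ℕ}
    (hli : l ≤ i) (hi : i ≤ N) :
    ∑ j : Fin N, (if l ≤ j.val ∧ j.val < i then f j else 0) = T i - T l := by
  induction i, hli using Nat.le_induction with
  | base =>
    rw [sub_self]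
    exact Finset.sum_eq_zero fun j _ => if_neg fun hj => absurd hj.2 hj.1.not_gt
  | succ i hli ih =>
    have e : ∀ j : Fin N, (if l ≤ j.val ∧ j.val < i + 1 then f j else 0) =
        (if l ≤ j.val ∧ j.val < i then f j else 0) + if j = ⟨i, hi⟩ then f j else 0 := by
      intro j
      rcases lt_trichotomy j.val i with hj | hj | hj
      · have : j ≠ ⟨i, hi⟩ := fun h => by simp [h] at hj
        simp [hj, this, Nat.lt_succ_of_lt hj]
      · have : j = ⟨i, hi⟩ := Fin.ext hj
        simp [this, hli]
      · have : j ≠ ⟨i, hi⟩ := fun h => by simp [h] at hj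
        simp [this, hj.not_gt, Nat.not_lt.2 (Nat.succ_le_of_lt hj)]
    simp only [e, Finset.sum_add_distrib, ih (Nat.le_of_succ_le hi), Finset.sum_ite_eq',
      Finset.mem_univ, if_true]
    rw [h]
    ring

/-- The scalars of a crossing of Hecke type with diagonal coefficients `a`, and of the caps `μ`,
such that partial sums of the `μ` telescope. -/
structure Telescopes {N : ℕ} (h : k) (a μ : Fin N → k) (T : ℕ → k) : Prop where
  ne : ∀ j, μ j ≠ 0
  diag_ne : ∀ j, a j ≠ 0
  quad : ∀ j, a j - (a j)⁻¹ = h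
  left : ∀ j, a j * μ j = T j
  right : ∀ j, (a j)⁻¹ * μ j = T (j + 1)

/-! ### Telescoping identities for curls and antiparallel crossings. -/

namespace Telescopes

variable {N : ℕ} {h : k} {a μ : Fin N → k} {T : ℕ → k}

theorem sub (H : Telescopes h a μ T) (j : Fin N) : -(h * μ j) = T (j + 1) - T j := by
  rw [← H.left, ← H.right, ← H.quad j]; ring

/-- Inverting both relations between μ and T exchanges the roles of a and a⁻¹, so the inverse
sequence telescopes the cup weights, with the opposite sign. -/
theorem sub_inv (H : Telescopes h a μ T) (j : Fin N) : h * (μ j)⁻¹ = (T (j + 1))⁻¹ - (T j)⁻¹ := by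
  rw [← H.left, ← H.right, ← H.quad j, mul_inv, mul_inv, inv_inv]; ring

theorem sum (H : Telescopes h a μ T) {l i : Fin N} (hl : l < i) :
    ∑ j, (if l < j ∧ j < i then h * μ j else 0) = (a l)⁻¹ * μ l - a i * μ i := by
  -- The open interval from l to i is the window starting at l + 1. Its ends are T_{l+1} = a_l⁻¹ μ_l
  -- and T_i = a_i μ_i, which is why a occurs with different exponents at the two ends.
  have := sum_window H.sub (Nat.succ_le_of_lt hl) i.isLt.le
  rw [H.left, H.right, ← neg_sub, ← this, ← Finset.sum_neg_distrib]
  refine Finset.sum_congr rfl fun j _ => ?_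
  by_cases hj : l < j ∧ j < i
  · rw [if_pos hj, if_pos (by exact hj), neg_neg]
  · rw [if_neg hj, if_neg (by exact hj), neg_zero]

theorem sum_inv (H : Telescopes h a μ T) {l i : Fin N} (hl : l < i) :
    ∑ j, (if l < j ∧ j < i then h * (μ j)⁻¹ else 0) = (a i)⁻¹ * (μ i)⁻¹ - a l * (μ l)⁻¹ := by
  have := sum_window (T := fun j => (T j)⁻¹) H.sub_inv (Nat.succ_le_of_lt hl) i.isLt.le
  have e : (a i)⁻¹ * (μ i)⁻¹ - a l * (μ l)⁻¹ = (T i)⁻¹ - (T (l + 1))⁻¹ := by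
    rw [← H.left, ← H.right, mul_inv, mul_inv, inv_inv]
  rw [e]
  exact this

/-- The diagonal term is T_i and the sum over j < i is T_0 - T_i. The dependence on i disappears, so
the curl acts by a scalar; the other three curls reach an end of T or T⁻¹ in the same way. -/
theorem curlR_pos (H : Telescopes h a μ T) (i : Fin N) :
    a i * μ i + ∑ j, (if j < i then h else 0) * μ j = T 0 := by
  have := sum_window H.sub (Nat.zero_le _) i.isLt.le
  rw [H.left, ← eq_sub_iff_add_eq', ← neg_sub, ← this, ← Finset.sum_neg_distrib]
  refine Finset.sum_congr rfl fun j _ => ?_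
  by_cases hj : j < i <;> simp [hj]

theorem curlR_neg (H : Telescopes h a μ T) (i : Fin N) :
    (a i)⁻¹ * μ i + ∑ j, (if i < j then -h else 0) * μ j = T N := by
  have := sum_window H.sub (Nat.succ_le_of_lt i.isLt) le_rfl
  rw [H.right, ← eq_sub_iff_add_eq']
  refine Eq.trans ?_ this
  refine Finset.sum_congr rfl fun j _ => ?_
  by_cases hj : i < j
  · simp [hj]
  · simp [hj]

theorem curlL_pos (H : Telescopes h a μ T) (i : Fin N) :
    (μ i)⁻¹ * a i + ∑ j, (μ j)⁻¹ * (if i < j then h else 0) = (T N)⁻¹ := by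
  have := sum_window (T := fun j => (T j)⁻¹) H.sub_inv (Nat.succ_le_of_lt i.isLt) le_rfl
  have e : (μ i)⁻¹ * a i = (T (i + 1))⁻¹ := by rw [← H.right, mul_inv, inv_inv, mul_comm]
  rw [e, ← eq_sub_iff_add_eq']
  refine Eq.trans ?_ this
  refine Finset.sum_congr rfl fun j _ => ?_
  by_cases hj : i < j
  · simp [hj, mul_comm]
  · simp [hj]

theorem curlL_neg (H : Telescopes h a μ T) (i : Fin N) :
    (μ i)⁻¹ * (a i)⁻¹ + ∑ j, (μ j)⁻¹ * (if j < i then -h else 0) = (T 0)⁻¹ := by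
  have := sum_window (T := fun j => (T j)⁻¹) H.sub_inv (Nat.zero_le _) i.isLt.le
  have e : (μ i)⁻¹ * (a i)⁻¹ = (T i)⁻¹ := by rw [← H.left, mul_inv, mul_comm]
  rw [e, ← eq_sub_iff_add_eq', ← neg_sub]
  refine Eq.trans ?_ (congrArg Neg.neg this)
  rw [← Finset.sum_neg_distrib]
  refine Finset.sum_congr rfl fun j _ => ?_
  by_cases hj : j < i <;> simp [hj, mul_comm]

/-- For l < i the intermediate indices run strictly between l and i, and their telescoped sum
cancels the two direct terms; otherwise every term vanishes. -/
theorem r2anti₁_pos (H : Telescopes h a μ T) (i l : Fin N) :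
    a i * ((μ l)⁻¹ * (if l < i then -h else 0) * μ i) + (if l < i then h else 0) * (a l)⁻¹ +
      ∑ j, (if j < i then h else 0) * ((μ l)⁻¹ * (if l < j then -h else 0) * μ j) = 0 := by
  have e : ∀ j, (if j < i then h else 0) * ((μ l)⁻¹ * (if l < j then -h else 0) * μ j) =
      -(h * (μ l)⁻¹) * if l < j ∧ j < i then h * μ j else 0 := by
    intro j; by_cases h₁ : l < j <;> by_cases h₂ : j < i <;> simp [h₁, h₂]; ring
  rw [Finset.sum_congr rfl fun j _ => e j, ← Finset.mul_sum]
  by_cases hl : l < i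
  · rw [H.sum hl, if_pos hl, if_pos hl]
    have := H.ne l
    field_simp
    ring
  · rw [Finset.sum_eq_zero fun j _ => if_neg fun h' => hl (h'.1.trans h'.2)]
    simp [hl]

theorem r2anti₂_pos (H : Telescopes h a μ T) (i l : Fin N) :
    (a i)⁻¹ * (if l < i then h else 0) + ((μ l)⁻¹ * (if l < i then -h else 0) * μ i) * a l +
      ∑ j, ((μ j)⁻¹ * (if j < i then -h else 0) * μ i) * (if l < j then h else 0) = 0 := by
  have e : ∀ j, ((μ j)⁻¹ * (if j < i then -h else 0) * μ i) * (if l < j then h else 0) =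
      -(h * μ i) * if l < j ∧ j < i then h * (μ j)⁻¹ else 0 := by
    intro j; by_cases h₁ : l < j <;> by_cases h₂ : j < i <;> simp [h₁, h₂]; ring
  rw [Finset.sum_congr rfl fun j _ => e j, ← Finset.mul_sum]
  by_cases hl : l < i
  · rw [H.sum_inv hl, if_pos hl, if_pos hl]
    have := mul_inv_cancel₀ (H.ne i)
    linear_combination -(h * (a i)⁻¹) * this
  · rw [Finset.sum_eq_zero fun j _ => if_neg fun h' => hl (h'.1.trans h'.2)]
    simp [hl]

theorem r2anti₁_neg (H : Telescopes h a μ T) (i l : Fin N) :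
    (a i)⁻¹ * ((μ l)⁻¹ * (if i < l then h else 0) * μ i) + (if i < l then -h else 0) * a l +
      ∑ j, (if i < j then -h else 0) * ((μ l)⁻¹ * (if j < l then h else 0) * μ j) = 0 := by
  have e : ∀ j, (if i < j then -h else 0) * ((μ l)⁻¹ * (if j < l then h else 0) * μ j) =
      -(h * (μ l)⁻¹) * if i < j ∧ j < l then h * μ j else 0 := by
    intro j; by_cases h₁ : i < j <;> by_cases h₂ : j < l <;> simp [h₁, h₂]; ring
  rw [Finset.sum_congr rfl fun j _ => e j, ← Finset.mul_sum]
  by_cases hl : i < l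
  · rw [H.sum hl, if_pos hl, if_pos hl]
    have := mul_inv_cancel₀ (H.ne l)
    linear_combination (h * a l) * this
  · rw [Finset.sum_eq_zero fun j _ => if_neg fun h' => hl (h'.1.trans h'.2)]
    simp [hl]

theorem r2anti₂_neg (H : Telescopes h a μ T) (i l : Fin N) :
    a i * (if i < l then -h else 0) + ((μ l)⁻¹ * (if i < l then h else 0) * μ i) * (a l)⁻¹ +
      ∑ j, ((μ j)⁻¹ * (if i < j then h else 0) * μ i) * (if j < l then -h else 0) = 0 := by
  have e : ∀ j, ((μ j)⁻¹ * (if i < j then h else 0) * μ i) * (if j < l then -h else 0) =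
      -(h * μ i) * if i < j ∧ j < l then h * (μ j)⁻¹ else 0 := by
    intro j; by_cases h₁ : i < j <;> by_cases h₂ : j < l <;> simp [h₁, h₂]; ring
  rw [Finset.sum_congr rfl fun j _ => e j, ← Finset.mul_sum]
  by_cases hl : i < l
  · rw [H.sum_inv hl, if_pos hl, if_pos hl]
    have := mul_inv_cancel₀ (H.ne i)
    linear_combination (h * a i) * this
  · rw [Finset.sum_eq_zero fun j _ => if_neg fun h' => hl (h'.1.trans h'.2)]
    simp [hl]

end Telescopes

/-- The telescoping sequence of `gl(m|n)`. -/
def teleSeq (t : k) (m n j : ℕ) : k :=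
  if j < m then t ^ ((n : ℤ) - m + 2 * j) else t ^ (3 * (m : ℤ) + n - 2 * j)

theorem telescopes_gl (t : k) (ht : t ≠ 0) (m n : ℕ) :
    Telescopes (N := m + n) (t⁻¹ - t) (fun i => if i.val < m then t⁻¹ else -t)
      (fun i => if i.val < m then t ^ (-(m : ℤ) + n - 1 + 2 * ((i.val : ℤ) + 1))
        else -t ^ (3 * (m : ℤ) + n + 1 - 2 * ((i.val : ℤ) + 1))) (teleSeq t m n) where
  ne j := by split_ifs <;> simp [zpow_ne_zero, ht]
  diag_ne j := by split_ifs <;> simp [ht]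
  quad j := by
    split_ifs
    · rw [inv_inv]
    · rw [inv_neg]; ring
  left j := by
    rw [teleSeq]; split_ifs
    · rw [← zpow_neg_one, ← zpow_add₀ ht]; congr 1; ring
    · rw [neg_mul_neg, ← zpow_one_add₀ ht]; congr 1; ring
  right j := by
    rw [teleSeq]
    by_cases h : j.val < m
    · rw [if_pos h, if_pos h, inv_inv, ← zpow_one_add₀ ht]
      split_ifs with h'
      · congr 1; push_cast; ring
      -- At the junction of even and odd vectors, T at index m follows the odd formula. The two
      -- exponents differ by 4m - 4(j + 1), which is zero here.
      · have : (m : ℤ) = j.val + 1 := by omega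
        congr 1; push_cast; linear_combination (-4 : ℤ) * this
    · rw [if_neg h, if_neg h, if_neg (by omega), inv_neg, neg_mul_neg, ← zpow_neg_one,
        ← zpow_add₀ ht]
      congr 1; push_cast; ring

theorem teleSeq_zero (t : k) (m n : ℕ) : teleSeq t m n 0 = t ^ ((n : ℤ) - m) := by
  rcases Nat.eq_zero_or_pos m with rfl | h
  · simp [teleSeq]
  · simp [teleSeq, h]

theorem teleSeq_last (t : k) (m n : ℕ) : teleSeq t m n (m + n) = t ^ ((m : ℤ) - n) := by
  rw [teleSeq, if_neg (by omega)]; congr 1; push_cast; ring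

end Scalars

/-! ### The braid relation for Hecke type crossings. -/

/-- Both sides of the braid relation are expanded on a basis triple. The coefficients of `kji`,
`jki` and `kij` agree outright; the hypothesis says that the difference on the other three vectors
vanishes. -/
theorem yang_baxter_smul {R X : Type*} [CommRing R] [AddCommGroup X] [Module R X]
    {aij aik ajk aji akj bij bik bjk bji bkj : R} {ijk jik ikj kij jki kji : X}
    (h : (bik * (aij * aji - ajk * akj) + bij * bjk * (bij - bjk)) • ijk +
      (aij * (bik * bji + bij * bjk - bjk * bik)) • jik +
      (ajk * (bij * bik - bik * bkj - bjk * bij)) • ikj = 0) :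
    aij • (aik • (ajk • kji + bjk • jki) + bik • (aji • ijk + bji • jik)) +
      bij • (ajk • (aik • kij + bik • ikj) + bjk • (aij • jik + bij • ijk)) =
    ajk • (aik • (aij • kji + bij • kij) + bik • (akj • ijk + bkj • ikj)) +
      bjk • (aij • (aik • jki + bik • jik) + bij • (ajk • ikj + bjk • ijk)) := by
  linear_combination (norm := module) h

/-- The coefficient identities behind the braid relation for Hecke type crossings. -/
theorem yang_baxter_coeffs {R X : Type*} [Field R] [AddCommGroup X] [Module R X] {N : ℕ} {h : R}
    {a : Fin N → R} {s : Fin N → Fin N → R} (ha : ∀ i, a i ≠ 0) (hq : ∀ i, a i - (a i)⁻¹ = h)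
    (hs : ∀ i j, s i j * s j i = 1) {A B : Fin N → Fin N → R}
    (hA : ∀ i j, A i j = if i = j then a i else s i j)
    (hB : ∀ i j, B i j = if j < i then h else 0) (v : Fin N → Fin N → Fin N → X) (i j l : Fin N) :
    (B i l * (A i j * A j i - A j l * A l j) + B i j * B j l * (B i j - B j l)) • v i j l +
      (A i j * (B i l * B j i + B i j * B j l - B j l * B i l)) • v j i l +
      (A j l * (B i j * B i l - B i l * B l j - B j l * B i j)) • v i l j = 0 := by
  have hsq : ∀ i, a i * a i - 1 - h * a i = 0 := fun i => by
    have := ha i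
    rw [← hq i]; field_simp; ring
  have hAne : ∀ {i j}, i ≠ j → A i j * A j i = 1 := fun {i j} hij => by
    rw [hA, hA, if_neg hij, if_neg hij.symm, hs]
  have hBB : ∀ i, B i i = 0 := fun i => by simp [hB]
  have hBa : ∀ i j, B i j * B j i = 0 := fun i j => by
    rw [hB, hB]; split_ifs with h₁ h₂
    · exact absurd h₁ h₂.not_gt
    all_goals simp
  have hBs : ∀ i j, B i j * B i j = h * B i j := fun i j => by rw [hB]; split_ifs <;> simp
  rcases eq_or_ne i j with rfl | hij
  · rcases eq_or_ne i l with rfl | hil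
    · simp [hBB]
    -- With two equal neighbouring indices, two of the three vectors coincide, and only the sum of
    -- their coefficients vanishes: this is where the quadratic relation `hsq` enters.
    · have e₁ : B i l * (A i i * A i i - A i l * A l i) + B i i * B i l * (B i i - B i l) +
          A i i * (B i l * B i i + B i i * B i l - B i l * B i l) = 0 := by
        rw [hAne hil, hBB, hA i i, if_pos rfl, hBs]
        linear_combination B i l * hsq i
      have e₂ : A i l * (B i i * B i l - B i l * B l i - B i l * B i i) = 0 := by
        rw [hBB, hBa]; ring
      rw [← add_smul, e₁, e₂, zero_smul, zero_smul, add_zero]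
  · rcases eq_or_ne j l with rfl | hjl
    · have e₁ : B i j * (A i j * A j i - A j j * A j j) + B i j * B j j * (B i j - B j j) +
          A j j * (B i j * B i j - B i j * B j j - B j j * B i j) = 0 := by
        rw [hAne hij, hBB, hA j j, if_pos rfl, hBs]
        linear_combination -B i j * hsq j
      have e₂ : A i j * (B i j * B j i + B i j * B j j - B j j * B i j) = 0 := by
        rw [hBB, hBa]; ring
      rw [add_right_comm, ← add_smul, e₁, e₂, zero_smul, zero_smul, add_zero]
    · have e₁ : B i j * B j l * (B i j - B j l) = 0 := by
        rw [hB, hB]; split_ifs <;> simp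
      -- Up to the factor h², the least of the indices is l exactly if l < i < j or l < j < i. The
      -- identity `e₃` is the same count with i as the greatest index. The case i = l is allowed.
      have e₂ : B i l * B j i + B i j * B j l - B j l * B i l = 0 := by
        simp only [hB]; split_ifs <;> first | omega | ring
      have e₃ : B i j * B i l - B i l * B l j - B j l * B i j = 0 := by
        simp only [hB]; split_ifs <;> first | omega | ring
      rw [hAne hij, hAne hjl, e₁, e₂, e₃]
      simp

end

section

variable (m n : ℕ)
/-! ### The crossings of the two kinds of strands -/

/-- The coefficient of the extra term of the positive crossing. -/
def posB (i j : Fin (m + n)) : K g := if j < i then q⁻¹ - q else 0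

/-- The coefficient of the extra term of the negative crossing. -/
def negB (i j : Fin (m + n)) : K g := if i < j then -(q⁻¹ - q) else 0

theorem hasCoeffs_pos :
    HasCoeffs (Qpos m n (g := g) alpha) (heckeCoeffs (posA m n) (posB m n)) :=
  hasCoeffs_hecke (pos_basis m n)

/-- Writing the coefficient as -h lets both classical crossings share the constant h = q⁻¹ - q of
`telescopes_alpha`. -/
theorem negB_eq (i j : Fin (m + n)) : (if i < j then q - q⁻¹ else 0 : K g) = negB m n i j := by
  rw [negB]; split_ifs
  · exact (neg_sub _ _).symm
  · rfl

theorem hasCoeffs_neg :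
    HasCoeffs (Qneg m n (g := g) alpha) (heckeCoeffs (negA m n) (negB m n)) :=
  hasCoeffs_hecke fun i j => (neg_basis m n i j).trans
    (congrArg (fun s : K g => (negA m n i j : K g) • tm (bu m n alpha j) (bu m n alpha i) +
      s • tm (bu m n alpha i) (bu m n alpha j)) (negB_eq m n i j))

theorem hasCoeffs_virt (c d : Color g) :
    HasCoeffs (Qvirt m n c d) (swapCoeffs (virtCoeff m n c d)) :=
  hasCoeffs_swap (virt_basis m n c d)

/-- The coefficients of a positive crossing with an over-strand of colour `z`. -/
def overCoeff (z : Palette g) : Ix m n (om z) → Ix m n (g := g) alpha → K g :=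
  fun _ j => oddCoeff m n (var z)⁻¹ j

/-- The coefficients of a negative crossing with an over-strand of colour `z`. -/
def overCoeff' (z : Palette g) : Ix m n (g := g) alpha → Ix m n (om z) → K g :=
  fun i _ => oddCoeff m n (var z) i

theorem hasCoeffs_overPos (z : Palette g) :
    HasCoeffs (Qpos m n (om z)) (swapCoeffs (overCoeff m n z)) :=
  hasCoeffs_swap (overPos_basis m n z)

theorem hasCoeffs_overNeg (z : Palette g) :
    HasCoeffs (Qneg m n (om z)) (swapCoeffs (overCoeff' m n z)) :=
  hasCoeffs_swap (overNeg_basis m n z)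

theorem oddCoeff_mul (s t : K g) (h : s * t = 1) (i : Fin (m + n)) :
    oddCoeff m n s i * oddCoeff m n t i = 1 := by
  rw [oddCoeff, oddCoeff]; split_ifs
  · exact one_mul 1
  · exact h

theorem overCoeff_mul (z : Palette g) (i : Ix m n (om z)) (j : Ix m n (g := g) alpha) :
    overCoeff m n z i j * overCoeff' m n z j i = 1 :=
  oddCoeff_mul m n _ _ (inv_mul_cancel₀ (var_ne_zero z)) j

theorem overCoeff_mul' (z : Palette g) (i : Ix m n (om z)) (j : Ix m n (g := g) alpha) :
    overCoeff' m n z j i * overCoeff m n z i j = 1 :=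
  oddCoeff_mul m n _ _ (mul_inv_cancel₀ (var_ne_zero z)) j

theorem virtA_mul (i j : Fin (m + n)) : (virtA m n i j * virtA m n j i : K g) = 1 := by
  rw [virtA, virtA]; split_ifs
  · exact one_mul 1
  · exact inv_mul_cancel₀ q_ne_zero
  · exact mul_inv_cancel₀ q_ne_zero
  · exact (neg_mul_neg _ _).trans (one_mul 1)

theorem virtCoeff_mul (c d : Color g) (i : Ix m n c) (j : Ix m n d) :
    virtCoeff m n c d i j * virtCoeff m n d c j i = 1 := by
  match c, d with
  | alpha, alpha => exact virtA_mul m n i j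
  | om _, alpha => exact one_mul 1
  | alpha, om _ => exact one_mul 1
  | om _, om _ => exact one_mul 1

theorem telescopes_alpha :
    Telescopes (q⁻¹ - q : K g) (diag m n) (mu m n alpha) (teleSeq q m n) :=
  telescopes_gl q q_ne_zero m n

theorem sgn_mul (i j : Fin (m + n)) : (sgn m n i j * sgn m n j i : K g) = 1 := by
  rw [sgn, sgn, mul_comm (par j), ← mul_pow]
  exact (congrArg (· ^ _) ((neg_mul_neg _ _).trans (one_mul 1))).trans (one_pow _)

theorem posA_negA (i j : Fin (m + n)) : (posA m n i j * negA m n j i : K g) = 1 := by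
  rcases eq_or_ne i j with rfl | h
  · rw [posA, negA, if_pos rfl, if_pos rfl]
    exact mul_inv_cancel₀ ((telescopes_alpha m n).diag_ne i)
  · rw [posA, negA, if_neg h, if_neg h.symm, sgn_mul]

theorem negA_posA (i j : Fin (m + n)) : (negA m n i j * posA m n j i : K g) = 1 := by
  rw [mul_comm, posA_negA]

theorem posB_negB (i j : Fin (m + n)) : (posB m n i j * negB m n i j : K g) = 0 := by
  rw [posB, negB]; split_ifs with h h'
  · exact absurd h h'.not_gt
  · exact mul_zero _
  · exact zero_mul _
  · exact zero_mul _

theorem posA_of_ne {i j : Fin (m + n)} (h : i ≠ j) : (posA m n i j : K g) = sgn m n i j := if_neg h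
theorem negA_of_ne {i j : Fin (m + n)} (h : i ≠ j) : (negA m n i j : K g) = sgn m n i j := if_neg h

/-- Off the diagonal the exchange coefficients of the two crossings agree, so this sign makes the
cross terms of the parallel second move cancel. -/
theorem negB_swap (i j : Fin (m + n)) : (negB m n j i : K g) = -posB m n i j := by
  rw [negB, posB]; split_ifs
  · rfl
  · exact neg_zero.symm

theorem posB_self (i : Fin (m + n)) : (posB m n i i : K g) = 0 := if_neg (lt_irrefl i)

theorem posA_negB (i j : Fin (m + n)) :
    (posA m n i j * negB m n j i + posB m n i j * negA m n i j : K g) = 0 := by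
  rw [negB_swap]
  rcases eq_or_ne i j with rfl | h
  · rw [posB_self]; ring
  · rw [posA_of_ne m n h, negA_of_ne m n h]; ring

theorem negA_posB (i j : Fin (m + n)) :
    (negA m n i j * posB m n j i + negB m n i j * posA m n i j : K g) = 0 := by
  rw [negB_swap]
  rcases eq_or_ne i j with rfl | h
  · rw [posB_self]; ring
  · rw [posA_of_ne m n h, negA_of_ne m n h]; ring

theorem posA_self (i : Fin (m + n)) : (posA m n i i : K g) = diag m n i := if_pos rfl
theorem negA_self (i : Fin (m + n)) : (negA m n i i : K g) = (diag m n i)⁻¹ := if_pos rfl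

variable (M : ModuleCat.{0} (K g))

theorem pos_neg_r2anti₁ :
    sideLMap (Qpos m n alpha) M ≫ sideRMap (Qneg m n alpha) M = 𝟙 _ :=
  hecke_r2anti₁ M (hasCoeffs_pos m n) (hasCoeffs_neg m n) (posA_negA m n) fun (i l : Fin (m + n)) => by
    rw [posA_self, negA_self]
    exact (telescopes_alpha m n).r2anti₁_pos i l

theorem neg_pos_r2anti₁ :
    sideLMap (Qneg m n alpha) M ≫ sideRMap (Qpos m n alpha) M = 𝟙 _ :=
  hecke_r2anti₁ M (hasCoeffs_neg m n) (hasCoeffs_pos m n) (negA_posA m n) fun (i l : Fin (m + n)) => by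
    rw [posA_self, negA_self]
    exact (telescopes_alpha m n).r2anti₁_neg i l

theorem pos_neg_r2anti₂ :
    sideRMap (Qneg m n alpha) M ≫ sideLMap (Qpos m n alpha) M = 𝟙 _ :=
  hecke_r2anti₂ M (hasCoeffs_pos m n) (hasCoeffs_neg m n) (negA_posA m n) fun (i l : Fin (m + n)) => by
    rw [posA_self, negA_self]
    exact (telescopes_alpha m n).r2anti₂_pos i l

theorem neg_pos_r2anti₂ :
    sideRMap (Qpos m n alpha) M ≫ sideLMap (Qneg m n alpha) M = 𝟙 _ :=
  hecke_r2anti₂ M (hasCoeffs_neg m n) (hasCoeffs_pos m n) (posA_negA m n) fun (i l : Fin (m + n)) => by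
    rw [posA_self, negA_self]
    exact (telescopes_alpha m n).r2anti₂_neg i l

theorem pos_neg_r2 : onTwo (Qpos m n alpha) M ≫ onTwo (Qneg m n alpha) M ≫ 𝟙 _ = 𝟙 _ :=
  hecke_r2 M (hasCoeffs_pos m n) (hasCoeffs_neg m n)
    (fun (i j : Fin (m + n)) => by rw [posA_negA, posB_negB, add_zero]) (posA_negB m n)

theorem neg_pos_r2 : onTwo (Qneg m n alpha) M ≫ onTwo (Qpos m n alpha) M ≫ 𝟙 _ = 𝟙 _ :=
  hecke_r2 M (hasCoeffs_neg m n) (hasCoeffs_pos m n)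
    (fun (i j : Fin (m + n)) => by rw [negA_posA, mul_comm (negB m n i j), posB_negB, add_zero]) (negA_posB m n)

theorem pos_r3 :
    onTwo (Qpos m n alpha) (Qletter m n (up alpha) ⊗ M) ≫
        Qletter m n (up alpha) ◁ onTwo (Qpos m n alpha) M ≫
        onTwo (Qpos m n alpha) (Qletter m n (up alpha) ⊗ M) ≫ 𝟙 _ =
      Qletter m n (up alpha) ◁ onTwo (Qpos m n alpha) M ≫
        onTwo (Qpos m n alpha) (Qletter m n (up alpha) ⊗ M) ≫
        Qletter m n (up alpha) ◁ onTwo (Qpos m n alpha) M ≫ 𝟙 _ := by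
  refine ap_ext_tm₃ (bu m n alpha) (bu m n alpha) (bu m n alpha) fun i j l w => ?_
  simp only [ap_comp, ap_id, ap_whiskerLeft, (hasCoeffs_pos m n).onTwo_hecke, map_add, map_smul,
    tm_add, tm_smul]
  exact yang_baxter_smul (yang_baxter_coeffs (telescopes_alpha m n).diag_ne
    (telescopes_alpha m n).quad (sgn_mul m n) (fun _ _ => rfl) (fun _ _ => rfl)
    (fun i j l => tm (bu m n alpha i) (tm (bu m n alpha j) (tm (bu m n alpha l) w))) i j l)

/-- A weight function that is multiplicative on pairs is preserved by a Hecke type crossing. -/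
theorem heckeCoeffs_weight {a : Color g} {A B : Ix m n a → Ix m n a → K g} {i j k l : Ix m n a}
    (h : heckeCoeffs A B i j k l ≠ 0) (f : Ix m n a → K g) : f l * f k = f i * f j := by
  by_cases h₁ : k = j ∧ l = i
  · rw [h₁.1, h₁.2]
  by_cases h₂ : k = i ∧ l = j
  · rw [h₂.1, h₂.2, mul_comm]
  · simp [heckeCoeffs, h₁, h₂] at h

theorem swapCoeffs_weight {a b : Color g} {A : Ix m n a → Ix m n b → K g} {i : Ix m n a}
    {j k : Ix m n b} {l : Ix m n a} (h : swapCoeffs A i j k l ≠ 0) (f : Ix m n a → K g)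
    (f' : Ix m n b → K g) : f l * f' k = f i * f' j := by
  by_cases h₁ : k = j ∧ l = i
  · rw [h₁.1, h₁.2]
  · simp [swapCoeffs, h₁] at h

theorem eq_smul_id {a : Color g}
    {ψ : Qletter m n (up a) ⊗ M ⟶ Qletter m n (up a) ⊗ M} {s : K g}
    (h : ∀ i w, ap ψ (tm (bu m n a i) w) = s • tm (bu m n a i) w) : ψ = s • 𝟙 _ :=
  ap_ext_tm (bu m n a) fun i w => by rw [h, ap_smul, ap_id]

end

section

variable (m n : ℕ)
/-! ### Invariance under the moves -/

/-- The elementary tangle acts on the leftmost factors and the slice on the remaining ones, so this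
is naturality in the remaining factor. -/
theorem Qlayer_lefts {u v : List (Letter g)} (L : Layer g u v) {s t : List (Letter g)}
    (e : Elem g s t) :
    Qelem m n e u ≫ Qlayer m n (L.lefts t) = Qlayer m n (L.lefts s) ≫ Qelem m n e v := by
  cases e with
  | pos c => exact onTwo_naturality (Qpos m n c) (Qlayer m n L)
  | neg c => exact onTwo_naturality (Qneg m n c) (Qlayer m n L)
  | virt c d => exact onTwo_naturality (Qvirt m n c d) (Qlayer m n L)
  | cupL c => exact onCup_naturality (QcupL m n c) (Qlayer m n L)
  | cupR c => exact onCup_naturality (QcupR m n c) (Qlayer m n L)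
  | capL c => exact onCap_naturality (QcapL m n c) (Qlayer m n L)
  | capR c => exact onCap_naturality (QcapR m n c) (Qlayer m n L)

/-! ### Straightening of strands. -/

section Zigzag

variable (c : Color g) (M : ModuleCat.{0} (K g))

theorem zigzag_up₁ : onCup (QcupL m n c) (Qletter m n (up c) ⊗ M) ≫
    Qletter m n (up c) ◁ onCap (QcapL m n c) M ≫ 𝟙 _ = 𝟙 _ :=
  ap_ext_tm (bu m n c) fun i w => by
    simp [ap_comp, ap_id, ap_onCup, cupL_one, asc_tm, ap_whiskerLeft, ap_onCap, capL_basis,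
      apply_ite (tm _), tm_zero]

theorem zigzag_up₂ : Qletter m n (up c) ◁ onCup (QcupR m n c) M ≫
    onCap (QcapR m n c) (Qletter m n (up c) ⊗ M) ≫ 𝟙 _ = 𝟙 _ :=
  ap_ext_tm (bu m n c) fun i w => by
    simp [ap_comp, ap_id, ap_onCup, cupR_one, asc_tm, ap_whiskerLeft, ap_onCap, capR_basis,
      tm_sum, tm_smul, smul_smul, mu_ne_zero]

theorem zigzag_dn₁ : Qletter m n (dn c) ◁ onCup (QcupL m n c) M ≫
    onCap (QcapL m n c) (Qletter m n (dn c) ⊗ M) ≫ 𝟙 _ = 𝟙 _ :=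
  ap_ext_tm (bd m n c) fun i w => by
    simp [ap_comp, ap_id, ap_onCup, cupL_one, asc_tm, ap_whiskerLeft, ap_onCap, capL_basis,
      tm_sum]

theorem zigzag_dn₂ : onCup (QcupR m n c) (Qletter m n (dn c) ⊗ M) ≫
    Qletter m n (dn c) ◁ onCap (QcapR m n c) M ≫ 𝟙 _ = 𝟙 _ :=
  ap_ext_tm (bd m n c) fun i w => by
    simp [ap_comp, ap_id, ap_onCup, cupR_one, asc_tm, ap_whiskerLeft, ap_onCap, capR_basis,
      apply_ite (tm _), tm_zero, tm_smul, smul_smul, mu_ne_zero]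

end Zigzag

/-! ### Values of classical and virtual curls. -/

/-- A right curl gives T_0 and a left curl T_{m+n}⁻¹. They agree because T_0 and T_{m+n} are inverse
to each other, so the side of a curl does not matter. -/
theorem Qmap_curl_pos (s : Bool) (r : List (Letter g)) :
    Qmap m n (curl (.pos alpha) s r) = (q ^ ((n : ℤ) - m) : K g) • 𝟙 (Qobj m n (up alpha :: r)) := by
  cases s
  · refine eq_smul_id m n (Qobj m n r) fun (i : Fin (m + n)) w =>
      ((hasCoeffs_pos m n).curlL_hecke _ i w).trans ?_
    refine congrArg (· • _) (Eq.trans ?_ (?_ : (teleSeq q m n (m + n))⁻¹ = _))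
    · rw [← (telescopes_alpha m n).curlL_pos i, ← posA_self]; rfl
    · rw [teleSeq_last, ← zpow_neg, neg_sub]
  · refine eq_smul_id m n (Qobj m n r) fun (i : Fin (m + n)) w =>
      ((hasCoeffs_pos m n).curlR_hecke _ i w).trans ?_
    refine congrArg (· • _) (Eq.trans ?_ (teleSeq_zero _ _ _))
    rw [← (telescopes_alpha m n).curlR_pos i, ← posA_self]; rfl

theorem Qmap_curl_neg (s : Bool) (r : List (Letter g)) :
    Qmap m n (curl (.neg alpha) s r) = (q ^ ((m : ℤ) - n) : K g) • 𝟙 (Qobj m n (up alpha :: r)) := by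
  cases s
  · refine eq_smul_id m n (Qobj m n r) fun (i : Fin (m + n)) w =>
      ((hasCoeffs_neg m n).curlL_hecke _ i w).trans ?_
    refine congrArg (· • _) (Eq.trans ?_ (?_ : (teleSeq q m n 0)⁻¹ = _))
    · rw [← (telescopes_alpha m n).curlL_neg i, ← negA_self]; rfl
    · rw [teleSeq_zero, ← zpow_neg, neg_sub]
  · refine eq_smul_id m n (Qobj m n r) fun (i : Fin (m + n)) w =>
      ((hasCoeffs_neg m n).curlR_hecke _ i w).trans ?_
    refine congrArg (· • _) (Eq.trans ?_ (teleSeq_last _ _ _))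
    rw [← (telescopes_alpha m n).curlR_neg i, ← negA_self]; rfl

theorem comp_smul_id {A : ModuleCat.{0} (K g)} {s t : K g} (h : s * t = 1) :
    (s • 𝟙 A) ≫ (t • 𝟙 A) = 𝟙 A :=
  ap_ext fun x => by
    simp only [ap_comp, ap_smul, ap_id, smul_smul]
    rw [mul_comm, h, one_smul]

theorem q_zpow_mul (k : ℤ) (l : ℤ) (h : k + l = 0) : (q ^ k * q ^ l : K g) = 1 := by
  rw [← zpow_add₀ q_ne_zero, h, zpow_zero]

theorem Qmap_curl_virt_om (z : Palette g) (s : Bool) (r : List (Letter g)) :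
    Qmap m n (curl (.virt (om z) (om z)) s r) = 𝟙 (Qobj m n (up (om z) :: r)) := by
  cases s
  · refine ap_ext_tm (bu m n (om z)) fun i w =>
      ((hasCoeffs_virt m n _ _).curlL_swap (Qobj m n r) i w).trans ?_
    simp only [virtCoeff, mu, mul_one, inv_one, one_smul]
    rfl
  · refine ap_ext_tm (bu m n (om z)) fun i w =>
      ((hasCoeffs_virt m n _ _).curlR_swap (Qobj m n r) i w).trans ?_
    simp only [virtCoeff, mu, mul_one, one_smul]
    rfl

/-- The signs 1, -1 of the virtual crossing match the weights q, -q of the right cap, so a virtual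
curl is a scalar. With two even vectors this fails: the signs are both 1 while the weights differ by
a factor q². -/
theorem virtA_mul_mu (i : Fin (1 + 1)) : (virtA 1 1 i i * mu 1 1 alpha i : K g) = q := by
  fin_cases i
  · simp [virtA, mu]
  · refine (neg_mul_neg _ _).trans ?_
    simp

theorem inv_mu_mul_virtA (i : Fin (1 + 1)) : ((mu 1 1 alpha i)⁻¹ * virtA 1 1 i i : K g) = q⁻¹ := by
  rw [← virtA_mul_mu i, mul_inv, mul_comm, inv_eq_of_mul_eq_one_left (virtA_mul 1 1 i i)]

theorem Qmap_curl_virt (c : Color g) (s : Bool) (r : List (Letter g)) :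
    ∃ k : ℤ, Qmap 1 1 (curl (.virt c c) s r) = (q ^ k : K g) • 𝟙 (Qobj 1 1 (up c :: r)) := by
  cases c with
  | om z =>
    refine ⟨0, (Qmap_curl_virt_om 1 1 z s r).trans ?_⟩
    rw [zpow_zero, one_smul]
  | alpha =>
    cases s
    · refine ⟨-1, eq_smul_id 1 1 (Qobj 1 1 r) fun i w =>
        ((hasCoeffs_virt 1 1 _ _).curlL_swap _ i w).trans (congrArg (· • _) ?_)⟩
      exact (inv_mu_mul_virtA i).trans (zpow_neg_one _).symm
    · refine ⟨1, eq_smul_id 1 1 (Qobj 1 1 r) fun i w =>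
        ((hasCoeffs_virt 1 1 _ _).curlR_swap _ i w).trans (congrArg (· • _) ?_)⟩
      exact (virtA_mul_mu i).trans (zpow_one _).symm

theorem Qmap_tangleMove {s t : List (Letter g)} {S T : Diagram g s t} (h : TangleMove s t S T) :
    Qmap m n S = Qmap m n T := by
  cases h with
  | interchange e L =>
    change Qelem m n e _ ≫ Qlayer m n (L.lefts _) ≫ 𝟙 _ = Qlayer m n (L.lefts _) ≫ Qelem m n e _ ≫ 𝟙 _
    rw [Category.comp_id, Category.comp_id, Qlayer_lefts]
  | zigzag₁ c r => exact zigzag_up₁ m n c (Qobj m n r)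
  | zigzag₂ c r => exact zigzag_up₂ m n c (Qobj m n r)
  | zigzag₃ c r => exact zigzag_dn₁ m n c (Qobj m n r)
  | zigzag₄ c r => exact zigzag_dn₂ m n c (Qobj m n r)
  | rotate h r =>
    cases h with
    | posNeg =>
      rename_i c
      cases c with
      | alpha => exact hecke_rotate (Qobj m n r) (hasCoeffs_pos m n)
      | om z => exact swap_rotate (Qobj m n r) (hasCoeffs_overPos m n z)
    | negPos =>
      rename_i c
      cases c with
      | alpha => exact hecke_rotate (Qobj m n r) (hasCoeffs_neg m n)
      | om z => exact swap_rotate (Qobj m n r) (hasCoeffs_overNeg m n z)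
    | virt =>
      rename_i c d
      exact swap_rotate (Qobj m n r) (hasCoeffs_virt m n c d)
  | r2 h r =>
    cases h with
    | posNeg =>
      rename_i c
      cases c with
      | alpha => exact pos_neg_r2 m n (Qobj m n r)
      | om z =>
        exact swap_r2 (Qobj m n r) (hasCoeffs_overPos m n z) (hasCoeffs_overNeg m n z)
          (overCoeff_mul m n z)
    | negPos =>
      rename_i c
      cases c with
      | alpha => exact neg_pos_r2 m n (Qobj m n r)
      | om z =>
        exact swap_r2 (Qobj m n r) (hasCoeffs_overNeg m n z) (hasCoeffs_overPos m n z)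
          fun i j => overCoeff_mul' m n z j i
    | virt =>
      rename_i c d
      exact swap_r2 (Qobj m n r) (hasCoeffs_virt m n c d) (hasCoeffs_virt m n d c)
        (virtCoeff_mul m n c d)
  | r2anti₁ h r =>
    refine (Qmap_comp m n _ _).trans ?_
    cases h with
    | posNeg =>
      rename_i c
      cases c with
      | alpha => exact pos_neg_r2anti₁ m n (Qobj m n r)
      | om z =>
        exact swap_r2anti₁ (Qobj m n r) (hasCoeffs_overPos m n z) (hasCoeffs_overNeg m n z)
          (overCoeff_mul m n z)
    | negPos =>
      rename_i c
      cases c with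
      | alpha => exact neg_pos_r2anti₁ m n (Qobj m n r)
      | om z =>
        exact swap_r2anti₁ (Qobj m n r) (hasCoeffs_overNeg m n z) (hasCoeffs_overPos m n z)
          fun i j => overCoeff_mul' m n z j i
    | virt =>
      rename_i c d
      exact swap_r2anti₁ (Qobj m n r) (hasCoeffs_virt m n c d) (hasCoeffs_virt m n d c)
        (virtCoeff_mul m n c d)
  | r2anti₂ h r =>
    refine (Qmap_comp m n _ _).trans ?_
    cases h with
    | posNeg =>
      rename_i c
      cases c with
      | alpha => exact pos_neg_r2anti₂ m n (Qobj m n r)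
      | om z =>
        exact swap_r2anti₂ (Qobj m n r) (hasCoeffs_overPos m n z) (hasCoeffs_overNeg m n z)
          (overCoeff_mul m n z)
    | negPos =>
      rename_i c
      cases c with
      | alpha => exact neg_pos_r2anti₂ m n (Qobj m n r)
      | om z =>
        exact swap_r2anti₂ (Qobj m n r) (hasCoeffs_overNeg m n z) (hasCoeffs_overPos m n z)
          fun i j => overCoeff_mul' m n z j i
    | virt =>
      rename_i c d
      exact swap_r2anti₂ (Qobj m n r) (hasCoeffs_virt m n c d) (hasCoeffs_virt m n d c)
        (virtCoeff_mul m n c d)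
  | r3 c r =>
    cases c with
    | alpha => exact pos_r3 m n (Qobj m n r)
    | om z =>
      exact slide_left (Qobj m n r) (hasCoeffs_pos m n) (hasCoeffs_overPos m n z)
        -- The Ω-strand rescales each α-strand by a factor depending only on its index, and the
        -- crossing below it permutes or keeps the two indices.
        (hasCoeffs_overPos m n z) fun i j k l x h => heckeCoeffs_weight m n h (overCoeff m n z x)
  | v3 a b c r =>
    exact slide_right (Qobj m n r) (hasCoeffs_virt m n a b) (hasCoeffs_virt m n a c)
      (hasCoeffs_virt m n b c) fun i j k l x h =>
        swapCoeffs_weight m n h (fun i => virtCoeff m n a c i x) (fun i => virtCoeff m n b c i x)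
  | mixed c e r =>
    cases c with
    | alpha =>
      exact slide_right (Qobj m n r) (hasCoeffs_pos m n) (hasCoeffs_virt m n alpha e)
        (hasCoeffs_virt m n alpha e) fun i j k l x h =>
          heckeCoeffs_weight m n h fun i => virtCoeff m n alpha e i x
    | om z =>
      exact slide_right (Qobj m n r) (hasCoeffs_overPos m n z) (hasCoeffs_virt m n (om z) e)
        (hasCoeffs_virt m n alpha e) fun i j k l x h =>
          swapCoeffs_weight m n h (fun i => virtCoeff m n (om z) e i x)
            (fun i => virtCoeff m n alpha e i x)
  | framed₁ s t r =>
    refine (Qmap_comp m n _ _).trans ?_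
    rw [Qmap_curl_pos, Qmap_curl_neg]
    exact comp_smul_id (q_zpow_mul _ _ (by ring))
  | framed₂ s t r =>
    refine (Qmap_comp m n _ _).trans ?_
    rw [Qmap_curl_pos, Qmap_curl_neg]
    exact comp_smul_id (q_zpow_mul _ _ (by ring))

theorem Qmap_semiWeldedMove {s t : List (Letter g)} {S T : Diagram g s t}
    (h : SemiWeldedMove s t S T) : Qmap m n S = Qmap m n T := by
  cases h with
  | intro z r =>
    exact slide_left (Qobj m n r) (hasCoeffs_virt m n alpha alpha) (hasCoeffs_overPos m n z)
      (hasCoeffs_overPos m n z) fun i j k l x h =>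
        swapCoeffs_weight m n h (overCoeff m n z x) (overCoeff m n z x)

/-! ### The commutator move -/

/-- The basis of the space of a strand with the given colour and orientation. -/
def bl (c : Color g) : (s : Bool) → Module.Basis (Ix m n c) (K g) (Qletter m n (ltr c s))
  | true => bu m n c
  | false => bd m n c

/-- The scalar by which an `Ω`-strand of orientation `t` acts on the odd part of an `α`-strand of
orientation `s` that passes under it from left to right. -/
def holonomy (s : Bool) (w : Palette g × Bool) : K g := if s = w.2 then var w.1 else (var w.1)⁻¹

/-- The value of `underOne` and `virtOne`, with its natural source and target. -/
def valTwo {a b : Letter g} {r : List (Letter g)} (S : Diagram g (a :: b :: r) (b :: a :: r)) :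
    Qletter m n a ⊗ (Qletter m n b ⊗ Qobj m n r) ⟶ Qletter m n b ⊗ (Qletter m n a ⊗ Qobj m n r) :=
  Qmap m n S

/-- Parallel orientations come from the negative crossing, with factor z; opposite orientations are
rotations of the positive crossing, with factor z⁻¹. Rotation keeps the scalar. -/
theorem underOne_basis (z : Palette g) (s t : Bool) (r : List (Letter g))
    (i : Ix m n (g := g) alpha) (j : Ix m n (om z)) (w : Qobj m n r) :
    ap (valTwo m n (underOne z s t r)) (tm (bl m n alpha s i) (tm (bl m n (om z) t j) w)) =
      oddCoeff m n (holonomy s (z, t)) i • tm (bl m n (om z) t j) (tm (bl m n alpha s i) w) := by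
  cases s <;> cases t
  · exact (hasCoeffs_overNeg m n z).rotL_swap (Qobj m n r) i j w
  · exact (hasCoeffs_overPos m n z).sideL_swap (Qobj m n r) i j w
  · exact (hasCoeffs_overPos m n z).sideR_swap (Qobj m n r) i j w
  · exact (hasCoeffs_overNeg m n z).onTwo_swap (Qobj m n r) i j w

theorem virtOne_basis (z : Palette g) (s t : Bool) (r : List (Letter g))
    (i : Ix m n (g := g) alpha) (j : Ix m n (om z)) (w : Qobj m n r) :
    ap (valTwo m n (virtOne z s t r)) (tm (bl m n alpha s i) (tm (bl m n (om z) t j) w)) =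
      tm (bl m n (om z) t j) (tm (bl m n alpha s i) w) := by
  refine Eq.trans ?_ (one_smul (K g) _)
  cases s <;> cases t
  · exact (hasCoeffs_virt m n alpha (om z)).rotL_swap (Qobj m n r) i j w
  · exact (hasCoeffs_virt m n (om z) alpha).sideL_swap (Qobj m n r) i j w
  · exact (hasCoeffs_virt m n (om z) alpha).sideR_swap (Qobj m n r) i j w
  · exact (hasCoeffs_virt m n alpha (om z)).onTwo_swap (Qobj m n r) i j w

theorem Qmap_left (a : Letter g) {s t : List (Letter g)} (S : Diagram g s t) :
    Qmap m n (S.left a) = Qletter m n a ◁ Qmap m n S := by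
  induction S with
  | nil s => exact (MonoidalCategory.whiskerLeft_id _ _).symm
  | cons L S ih =>
    change (Qletter m n a ◁ Qlayer m n L) ≫ Qmap m n (S.left a) = _
    rw [ih]
    exact (MonoidalCategory.whiskerLeft_comp _ _ _).symm

/-- The value of `underAll` and `virtAll`, with its natural source. -/
def valPass {a : Letter g} {r t : List (Letter g)} (S : Diagram g (a :: r) t) :
    Qletter m n a ⊗ Qobj m n r ⟶ Qobj m n t :=
  Qmap m n S

theorem oddCoeff_mul_oddCoeff (s t : K g) (i : Fin (m + n)) :
    oddCoeff m n s i * oddCoeff m n t i = oddCoeff m n (s * t) i := by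
  simp only [oddCoeff]; split_ifs <;> simp

/-- The scalar depends on the vector `x` of the α-strand, so the two morphisms are compared with `x`
held fixed and only the other factors vary. -/
theorem ap_tm_smul_ext {A B C D : ModuleCat.{0} (K g)} {κ : Type*} (b : Module.Basis κ (K g) B)
    {f h : A ⊗ (B ⊗ C) ⟶ D} (x : A) (c : K g)
    (H : ∀ j w, ap f (tm x (tm (b j) w)) = c • ap h (tm x (tm (b j) w)))
    (v : (B ⊗ C : ModuleCat.{0} (K g))) : ap f (tm x v) = c • ap h (tm x v) := by
  have e : ap f ∘ₗ TensorProduct.mk (K g) A (B ⊗ C : ModuleCat.{0} (K g)) x =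
      c • (ap h ∘ₗ TensorProduct.mk (K g) A (B ⊗ C : ModuleCat.{0} (K g)) x) :=
    TensorProduct.ext (b.ext fun j => LinearMap.ext fun w => H j w)
  exact LinearMap.congr_fun e v

theorem underAll_basis (s : Bool) (r : List (Letter g)) (ws : List (Palette g × Bool))
    (i : Ix m n (g := g) alpha) (v : Qobj m n (strands ws r)) :
    ap (valPass m n (underAll s r ws)) (tm (bl m n alpha s i) v) =
      oddCoeff m n (ws.map (holonomy s)).prod i •
        ap (valPass m n (virtAll s r ws)) (tm (bl m n alpha s i) v) := by
  induction ws with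
  | nil =>
    have h : (oddCoeff m n (1 : K g) i) = 1 := by simp [oddCoeff]
    rw [List.map_nil, List.prod_nil, h, one_smul]
    rfl
  | cons w ws ih =>
    have hu : valPass m n (underAll s r (w :: ws)) = valTwo m n (underOne w.1 s w.2 (strands ws r)) ≫
        Qletter m n (ltr (om w.1) w.2) ◁ valPass m n (underAll s r ws) :=
      (Qmap_comp m n _ _).trans (congrArg _ (Qmap_left m n _ _))
    have hv : valPass m n (virtAll s r (w :: ws)) = valTwo m n (virtOne w.1 s w.2 (strands ws r)) ≫
        Qletter m n (ltr (om w.1) w.2) ◁ valPass m n (virtAll s r ws) :=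
      (Qmap_comp m n _ _).trans (congrArg _ (Qmap_left m n _ _))
    rw [hu, hv]
    refine ap_tm_smul_ext (bl m n (om w.1) w.2) _ _ (fun j u => ?_) v
    refine (congrArg (ap (Qletter m n (ltr (om w.1) w.2) ◁ valPass m n (underAll s r ws)))
      (underOne_basis m n w.1 s w.2 (strands ws r) i j u)).trans ?_
    refine Eq.trans ?_ (congrArg (fun t => oddCoeff m n ((w :: ws).map (holonomy s)).prod i •
      ap (Qletter m n (ltr (om w.1) w.2) ◁ valPass m n (virtAll s r ws)) t)
      (virtOne_basis m n w.1 s w.2 (strands ws r) i j u)).symm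
    rw [map_smul, ap_whiskerLeft, ap_whiskerLeft, ih, tm_smul, smul_smul, List.map_cons,
      List.prod_cons]
    exact congrArg (· • _) (oddCoeff_mul_oddCoeff m n _ _ i)

/-- Each block of four strands contributes a commutator of x_i^{±1} and y_i^{±1}, which is trivial
since the scalars commute. -/
theorem prod_holonomy_commWord (s : Bool) : ((commWord g).map (holonomy s)).prod = 1 := by
  rw [commWord, List.map_flatMap]
  induction List.finRange g with
  | nil => rfl
  | cons i l ih =>
    rw [List.flatMap_cons, List.prod_append, ih, mul_one]
    have hx := var_ne_zero (g := g) (x i)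
    have hy := var_ne_zero (g := g) (y i)
    cases s <;> simp [holonomy] <;> field_simp

theorem Qmap_commutatorMove {s t : List (Letter g)} {S T : Diagram g s t}
    (h : CommutatorMove s t S T) : Qmap m n S = Qmap m n T := by
  cases h with
  | intro s r =>
    refine ap_ext_tm (bl m n alpha s) fun i v => (underAll_basis m n s r (commWord g) i v).trans ?_
    have h : (oddCoeff m n (1 : K g) i) = 1 := by simp [oddCoeff]
    rw [prod_holonomy_commWord, h, one_smul]
    rfl

/-! ### Functoriality -/

/-- Strands on the right are part of each move, and diagrams above and below are handled by
functoriality; only whiskering on the left remains. -/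
theorem Qmap_eq_of_leftClosure {R : MoveFamily g}
    (hR : ∀ {s t : List (Letter g)} {S T : Diagram g s t}, R s t S T → Qmap m n S = Qmap m n T)
    {s t : List (Letter g)} {S T : Diagram g s t} (h : LeftClosure R s t S T) :
    Qmap m n S = Qmap m n T := by
  induction h with
  | base h => exact hR h
  | left a _ ih => rw [Qmap_left, Qmap_left, ih]

theorem Qmap_frRotMoves {s t : List (Letter g)} {S T : Diagram g s t} (h : frRotMoves s t S T) :
    Qmap m n S = Qmap m n T := by
  rcases h with h | h | h | h
  · exact Qmap_tangleMove m n h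
  · exact Qmap_semiWeldedMove m n h
  · exact Qmap_commutatorMove m n h
  · obtain ⟨c, hc, s, r⟩ := h
    cases c with
    | alpha => exact absurd rfl hc
    | om z => exact Qmap_curl_virt_om m n z s r

/-- Equality up to a power of `q`. -/
def EqUpToPower {A B : ModuleCat.{0} (K g)} (f h : A ⟶ B) : Prop :=
  ∃ k : ℤ, f = (q ^ k : K g) • h

theorem EqUpToPower.of_eq {A B : ModuleCat.{0} (K g)} {f h : A ⟶ B} (e : f = h) :
    EqUpToPower f h := ⟨0, by rw [zpow_zero, one_smul, e]⟩

theorem Qmap_allMoves {s t : List (Letter g)} {S T : Diagram g s t} (h : allMoves s t S T) :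
    EqUpToPower (Qmap 1 1 S) (Qmap 1 1 T) := by
  rcases h with h | h | h
  · exact .of_eq (Qmap_frRotMoves 1 1 h)
  · cases h with
    | pos s r => exact ⟨_, Qmap_curl_pos 1 1 s r⟩
    | neg s r => exact ⟨_, Qmap_curl_neg 1 1 s r⟩
  · obtain ⟨c, _, s, r⟩ := h
    exact Qmap_curl_virt c s r

theorem Qmap_leftClosure_allMoves {s t : List (Letter g)} {S T : Diagram g s t}
    (h : LeftClosure allMoves s t S T) : EqUpToPower (Qmap 1 1 S) (Qmap 1 1 T) := by
  induction h with
  | base h => exact Qmap_allMoves h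
  | left a _ ih =>
    obtain ⟨k, hk⟩ := ih
    refine ⟨k, ?_⟩
    rw [Qmap_left, Qmap_left, hk]
    exact MonoidalLinear.whiskerLeft_smul _ _ _

/-- Equality of the values of two diagrams up to a power of `q`. -/
def valueRel (g : ℕ) : HomRel (DiagObj g) :=
  fun _ _ S T => EqUpToPower ((Qdiag 1 1 g).map S) ((Qdiag 1 1 g).map T)

/-- Powers of q are closed under products and inverses, and composition is linear in each factor. -/
instance : Congruence (valueRel g) where
  equivalence :=
    { refl := fun _ => .of_eq rfl
      symm := by
        rintro S T ⟨k, hk⟩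
        refine ⟨-k, ?_⟩
        rw [hk, smul_smul, q_zpow_mul _ _ (neg_add_cancel k), one_smul]
      trans := by
        rintro S T R ⟨k, hk⟩ ⟨l, hl⟩
        refine ⟨k + l, ?_⟩
        rw [hk, hl, smul_smul, zpow_add₀ q_ne_zero] }
  comp_left S := by
    rintro T T' ⟨k, hk⟩
    refine ⟨k, ?_⟩
    rw [Functor.map_comp, Functor.map_comp, hk, Linear.comp_smul]
  comp_right S := by
    rintro ⟨k, hk⟩
    refine ⟨k, ?_⟩
    rw [Functor.map_comp, Functor.map_comp, hk, Linear.smul_comp]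

end

end

end Prismatic

/-! ### Descent to the quotient categories. -/

theorem theorem4p1 (g : ℕ) :
    (∀ m n : ℕ,
      (∃! F : Prismatic.PTfrRot g ⥤ ModuleCat.{0} (Prismatic.K g),
        CategoryTheory.Quotient.functor _ ⋙ F = Prismatic.Qdiag m n g) ∧
      (∀ (s t : List (Prismatic.Letter g)) (S T : Prismatic.Diagram g s t),
        Prismatic.LeftClosure Prismatic.SemiWeldedMove s t S T →
          Prismatic.Qmap m n S = Prismatic.Qmap m n T) ∧
      (∀ (s t : List (Prismatic.Letter g)) (S T : Prismatic.Diagram g s t),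
        Prismatic.LeftClosure Prismatic.CommutatorMove s t S T →
          Prismatic.Qmap m n S = Prismatic.Qmap m n T)) ∧
    (∀ (a b : Prismatic.DiagObj g) (S T : a ⟶ b),
      (CategoryTheory.Quotient.functor (Prismatic.allMoves (g := g)).homRel).map S =
          (CategoryTheory.Quotient.functor (Prismatic.allMoves (g := g)).homRel).map T →
        ∃ k : ℤ, (Prismatic.Qdiag 1 1 g).map S =
          (Prismatic.q ^ k : Prismatic.K g) • (Prismatic.Qdiag 1 1 g).map T) := by
  refine ⟨fun m n => ⟨?_, fun s t S T h => ?_, fun s t S T h => ?_⟩, fun a b S T h => ?_⟩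
  · have H : ∀ (a b : Prismatic.DiagObj g) (S T : a ⟶ b),
        (Prismatic.frRotMoves (g := g)).homRel S T →
          (Prismatic.Qdiag m n g).map S = (Prismatic.Qdiag m n g).map T :=
      fun _ _ _ _ h => Prismatic.Qmap_eq_of_leftClosure m n (Prismatic.Qmap_frRotMoves m n) h
    exact ⟨CategoryTheory.Quotient.lift _ _ H, CategoryTheory.Quotient.lift_spec _ _ H, fun F hF =>
      CategoryTheory.Quotient.lift_unique _ _ H F hF⟩
  · exact Prismatic.Qmap_eq_of_leftClosure m n (Prismatic.Qmap_semiWeldedMove m n) h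
  · exact Prismatic.Qmap_eq_of_leftClosure m n (Prismatic.Qmap_commutatorMove m n) h
  -- Equality modulo all moves is an equivalence closure. Instead of inducting over it, the quotient
  -- by the moves is mapped to the quotient by `valueRel`; as `valueRel` is a congruence, equality
  -- there is the relation itself.
  · have H : ∀ (a b : Prismatic.DiagObj g) (S T : a ⟶ b),
        (Prismatic.allMoves (g := g)).homRel S T →
          (CategoryTheory.Quotient.functor (Prismatic.valueRel g)).map S =
            (CategoryTheory.Quotient.functor (Prismatic.valueRel g)).map T :=
      fun _ _ _ _ h => CategoryTheory.Quotient.sound _ (Prismatic.Qmap_leftClosure_allMoves h)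
    exact (CategoryTheory.Quotient.functor_map_eq_iff (Prismatic.valueRel g) S T).1
      (congrArg (CategoryTheory.Quotient.lift _ _ H).map h)
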